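/- **Conventions.** A *Galois structure* $\Gamma=(\mathscr C,\mathscr X,I,H,\eta,\epsilon,\mathcal E,\mathcal F)$ consists of an adjunction $I\dashv H$, $I\colon\mathscr C\to\mathscr X$, with unit $\eta$ and counit $\epsilon$, and classes $\mathcal E$, $\mathcal F$ of morphisms of $\mathscr C$ and $\mathscr X$ that contain all isomorphisms and are closed under composition and under pullback (pullbacks of morphisms of the class along arbitrary morphisms exist and are in the class), such that $I(\mathcal E)\subseteq\mathcal F$ and $H(\mathcal F)\subseteq\mathcal E$. Morphisms in $\mathcal E$ are called *extensions*; $(\mathscr C\downarrow_{\mathcal E}B)$ is the full subcategory of $(\mathscr C\downarrow B)$ on the extensions of $B$, and similarly $(\mathscr X\downarrow_{\mathcal F}Y)$. For a class $\mathcal P$ of morphisms, $\mathrm{Split}(\mathcal P)$ is the class of the split epimorphisms in $\mathcal P$, and $\Gamma_{\mathrm{Split}}$ is the Galois structure obtained from $\Gamma$ by replacing $\mathcal E,\mathcal F$ with $\mathrm{Split}(\mathcal E),\mathrm{Split}(\mathcal F)$. $\Gamma$ is *admissible* if for every $B\in\mathscr C$ the functor $H^B\colon(\mathscr X\downarrow_{\mathcal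 F}I(B))\to(\mathscr C\downarrow_{\mathcal E}B)$, which sends $\varphi$ to the pullback of $H(\varphi)$ along $\eta_B$, is fully faithful. An extension $f\colon A\to B$ is *trivial* if the naturality square of $\eta$ at $f$ is a pullback; *monadic* if the change-of-base functor $f^*\colon(\mathscr C\downarrow_{\mathcal E}B)\to(\mathscr C\downarrow_{\mathcal E}A)$ is monadic; *normal* if it is monadic and $f^*(f)$ is trivial. $\mathrm{MExt}_{\mathcal E}(B)$ and $\mathrm{NExt}_\Gamma(B)$ are the full subcategories of $(\mathscr C\downarrow_{\mathcal E}B)$ given by the monadic and the normal extensions of $B$. For a monadic extension $p\colon E\to B$, $\mathrm{SSpl}_\Gamma(E,p)$ is the full subcategory of $(\mathscr C\downarrow_{\mathcal E}B)$ on those extensions $f$ for which $p^*(f)$ is both a trivial extension and a split epimorphism. A *weakly universal* monadic (respectively normal) extension of $B$ is a weakly initial object of $\mathrm{MExt}_{\mathcal E}(B)$ (respectively $\mathrm{NExt}_\Gamma(B)$). For an internal groupoid $G$ with objects $G_0$, arrows $G_1$ and composable pairs $G_2$ in a category $\mathscr Y$, a *discrete fibration* $G'\to G$ is an internal functor $(f_0,f_1,f_2)$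 whose commutative squares with respect to domain, codomain, unit, composition and the two projections are all pullbacks. For a class $\mathcal P$ of morphisms of $\mathscr Y$, $\mathscr Y^{\downarrow_{\mathcal P}G}$ is the full subcategory of the comma category (internal groupoids in $\mathscr Y$) $\downarrow G$ on the discrete fibrations with $f_0,f_1,f_2\in\mathcal P$. **Theorem.** Let $\Gamma=(\mathscr C,\mathscr X,I,H,\eta,\epsilon,\mathcal E,\mathcal F)$ be a Galois structure such that 1. $I$ preserves every pullback square $$\begin{array}{ccc} D&\longrightarrow& A\\ \downarrow&&\downarrow f\\ K&\xrightarrow{\ g\ }&B\end{array}$$ in which $f$ is a split epimorphism and $f,g\in\mathcal E$; 2. $\Gamma_{\mathrm{Split}}$ is admissible. For an extension $p\colon E\to B$, let $\mathrm{Gal}_\Gamma(E,p)=I(\mathrm{Eq}(p))$ be the image under $I$ of the kernel pair groupoid $\mathrm{Eq}(p)$ of $p$; by (1), it is an internal groupoid in $\mathscr X$. Then for every monadic extension $p\colon E\to B$ there is an equivalence of categories $$\mathrm{SSpl}_\Gamma(E,p)\simeq\mathscr X^{\downarrow_{\mathrm{Split}(\mathcal F)}\mathrm{Gal}_\Gamma(E,p)}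 .$$ Hence, if $p$ is such that $\mathrm{SSpl}_\Gamma(E,p)=\mathrm{NExt}_\Gamma(B)$, there is an equivalence of categories $$\mathrm{NExt}_\Gamma(B)\simeq\mathscr X^{\downarrow_{\mathrm{Split}(\mathcal F)}\mathrm{Gal}_\Gamma(E,p)} .$$ The equality $\mathrm{SSpl}_\Gamma(E,p)=\mathrm{NExt}_\Gamma(B)$ holds, in particular, whenever $p$ is a weakly universal monadic extension of $B$ or a weakly universal normal extension of $B$. -/

import Mathlib

open CategoryTheory CategoryTheory.Limits

universe v₁ v₂ u₁ u₂

/-! ### Split epimorphisms in a class -/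

/-- The class `Split(P)` of those morphisms in `P` that are also split epimorphisms. -/
def splitPart {C : Type u₁} [Category.{v₁} C] (P : MorphismProperty C) : MorphismProperty C :=
  fun _ _ f => P f ∧ IsSplitEpi f

theorem isSplitEpi_of_isPullback {C : Type u₁} [Category.{v₁} C] {P A B D : C}
    {a : P ⟶ A} {b : P ⟶ B} {f : A ⟶ D} {g : B ⟶ D} (h : IsPullback a b f g)
    (hf : IsSplitEpi f) : IsSplitEpi b :=
  IsSplitEpi.mk' ⟨h.lift (g ≫ section_ f) (𝟙 B) (by simp), by simp⟩

instance splitPart_isMultiplicative {C : Type u₁} [Category.{v₁} C] (P : MorphismProperty C)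
    [P.IsMultiplicative] : (splitPart P).IsMultiplicative where
  id_mem X := ⟨P.id_mem X, inferInstance⟩
  comp_mem f g hf hg := by
    have := hf.2
    have := hg.2
    exact ⟨P.comp_mem f g hf.1 hg.1, inferInstance⟩

instance splitPart_isStableUnderBaseChange {C : Type u₁} [Category.{v₁} C]
    (P : MorphismProperty C) [P.IsStableUnderBaseChange] :
    (splitPart P).IsStableUnderBaseChange where
  of_isPullback h hg :=
    ⟨P.of_isPullback h hg.1, isSplitEpi_of_isPullback h hg.2⟩

instance splitPart_hasPullbacks {C : Type u₁} [Category.{v₁} C] (P : MorphismProperty C)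
    [P.HasPullbacks] : (splitPart P).HasPullbacks where
  hasPullback g hf := P.hasPullback g hf.1

/-! ### Galois structures -/

/-- A Galois structure: an adjunction `I ⊣ H` between `C` and `X`, with a class `E` of morphisms
of `C` (the extensions) and a class `F` of morphisms of `X`. Both classes contain the isomorphisms,
are closed under composition and closed under pullback: a pullback of a morphism of the class along
an arbitrary morphism exists and is again in the class. (Containing the identities and being stable
under pullback amounts to containing all isomorphisms, see `GaloisStructure.E_of_isIso`.) -/
structure GaloisStructure (C : Type u₁) [Category.{v₁} C] (X : Type u₂) [Category.{v₂} X] where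
  I : C ⥤ X
  H : X ⥤ C
  adj : I ⊣ H
  E : MorphismProperty C
  F : MorphismProperty X
  [E_mult : E.IsMultiplicative]
  [E_stable : E.IsStableUnderBaseChange]
  [E_pullbacks : E.HasPullbacks]
  [F_mult : F.IsMultiplicative]
  [F_stable : F.IsStableUnderBaseChange]
  [F_pullbacks : F.HasPullbacks]
  map_I : ∀ {A B : C} (f : A ⟶ B), E f → F (I.map f)
  map_H : ∀ {A B : X} (f : A ⟶ B), F f → E (H.map f)

attribute [instance] GaloisStructure.E_mult GaloisStructure.E_stable GaloisStructure.E_pullbacks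
  GaloisStructure.F_mult GaloisStructure.F_stable GaloisStructure.F_pullbacks

namespace GaloisStructure

variable {C : Type u₁} [Category.{v₁} C] {X : Type u₂} [Category.{v₂} X]

theorem E_of_isIso (Γ : GaloisStructure C X) {A B : C} (f : A ⟶ B) [IsIso f] : Γ.E f :=
  Γ.E.of_isIso f

/-- The induced Galois structure `Γ_Split`, with `E` and `F` replaced by `Split(E)`, `Split(F)`. -/
def split (Γ : GaloisStructure C X) : GaloisStructure C X where
  I := Γ.I
  H := Γ.H
  adj := Γ.adj
  E := splitPart Γ.E
  F := splitPart Γ.F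
  map_I f hf := by
    have := hf.2
    exact ⟨Γ.map_I f hf.1, inferInstance⟩
  map_H f hf := by
    have := hf.2
    exact ⟨Γ.map_H f hf.1, inferInstance⟩

/-- The functor `(X ↓_F Y) ⥤ (C ↓_E H(Y))` sending `φ` to `H(φ)`. -/
def overH (Γ : GaloisStructure C X) (Y : X) :
    Γ.F.Over ⊤ Y ⥤ Γ.E.Over ⊤ (Γ.H.obj Y) where
  obj A := MorphismProperty.Over.mk ⊤ (Γ.H.map A.hom) (Γ.map_H _ A.prop)
  map {A B} f := MorphismProperty.Over.homMk (Γ.H.map f.left)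
    (by
      have h : f.left ≫ B.hom = A.hom := MorphismProperty.Over.w f
      exact (Γ.H.map_comp _ _).symm.trans (congrArg Γ.H.map h)) trivial

/-- The functor `H^B : (X ↓_F I(B)) ⥤ (C ↓_E B)`: apply `H`, then pull back along the unit
`η_B : B ⟶ H(I(B))`. -/
noncomputable def inducedH (Γ : GaloisStructure C X) (B : C) :
    Γ.F.Over ⊤ (Γ.I.obj B) ⥤ Γ.E.Over ⊤ B :=
  Γ.overH (Γ.I.obj B) ⋙ MorphismProperty.Over.pullback Γ.E ⊤ (Γ.adj.unit.app B)

/-- `Γ` is admissible when every `H^B` is fully faithful. -/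
def IsAdmissible (Γ : GaloisStructure C X) : Prop :=
  ∀ B : C, (Γ.inducedH B).Full ∧ (Γ.inducedH B).Faithful

/-- `I` preserves those pullbacks of `f : A ⟶ B` along `g : K ⟶ B` for which `f` is a split
epimorphism and `f` and `g` are extensions. -/
def PreservesSplitPullbacks (Γ : GaloisStructure C X) : Prop :=
  ∀ ⦃D A K B : C⦄ (a : D ⟶ A) (k : D ⟶ K) (f : A ⟶ B) (g : K ⟶ B),
    IsPullback a k f g → IsSplitEpi f → Γ.E f → Γ.E g →
      IsPullback (Γ.I.map a) (Γ.I.map k) (Γ.I.map f) (Γ.I.map g)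

/-- An extension is trivial if its naturality square for the unit is a pullback. -/
def IsTrivialExtension (Γ : GaloisStructure C X) {A B : C} (f : A ⟶ B) : Prop :=
  Γ.E f ∧ IsPullback (Γ.adj.unit.app A) f (Γ.H.map (Γ.I.map f)) (Γ.adj.unit.app B)

/-- An extension `f : A ⟶ B` is monadic if `f^* : (C ↓_E B) ⥤ (C ↓_E A)` is monadic. -/
def IsMonadicExtension (Γ : GaloisStructure C X) {A B : C} (f : A ⟶ B) : Prop :=
  Γ.E f ∧ Nonempty (MonadicRightAdjoint (MorphismProperty.Over.pullback Γ.E ⊤ f))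

/-- `p^*(f)`, for an extension `f : A ⟶ B`, given as an object of `(C ↓_E B)`. -/
noncomputable abbrev baseChange (Γ : GaloisStructure C X) {P B : C} (p : P ⟶ B)
    (f : Γ.E.Over ⊤ B) : pullback f.hom p ⟶ P :=
  pullback.snd f.hom p

/-- The extensions of `B` split by `p`: those `f` with `p^*(f)` trivial. -/
def Spl (Γ : GaloisStructure C X) {P B : C} (p : P ⟶ B) : ObjectProperty (Γ.E.Over ⊤ B) :=
  fun f => Γ.IsTrivialExtension (Γ.baseChange p f)

/-- The objects `f` of `Spl(P, p)` for which `p^*(f)` is moreover a split epimorphism. -/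
def SSpl (Γ : GaloisStructure C X) {P B : C} (p : P ⟶ B) : ObjectProperty (Γ.E.Over ⊤ B) :=
  fun f => Γ.Spl p f ∧ IsSplitEpi (Γ.baseChange p f)

/-- The monadic extensions of `B`. -/
def MExt (Γ : GaloisStructure C X) (B : C) : ObjectProperty (Γ.E.Over ⊤ B) :=
  fun f => Γ.IsMonadicExtension f.hom

/-- The normal extensions of `B`: the monadic extensions that are split by themselves. -/
def NExt (Γ : GaloisStructure C X) (B : C) : ObjectProperty (Γ.E.Over ⊤ B) :=
  fun f => Γ.IsMonadicExtension f.hom ∧ Γ.Spl f.hom f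

end GaloisStructure

/-- `p` is a weakly initial object of the full subcategory of `D` given by `Q`. -/
def IsWeaklyInitialIn {D : Type u₁} [Category.{v₁} D] (Q : ObjectProperty D) (p : D) : Prop :=
  Q p ∧ ∀ f : D, Q f → Nonempty (p ⟶ f)

/-! ### Internal groupoids -/

/-- An internal groupoid in a category. Composition `m` takes a composable pair (`x`, `y`), with
`c x = d y`, to an arrow from `d x` to `c y`. Associativity is stated for generalized elements, so
that the object of composable triples need not be mentioned. -/
structure InternalGroupoid (C : Type u₁) [Category.{v₁} C] where
  G₀ : C
  G₁ : C
  G₂ : C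
  d : G₁ ⟶ G₀
  c : G₁ ⟶ G₀
  e : G₀ ⟶ G₁
  σ : G₁ ⟶ G₁
  p₁ : G₂ ⟶ G₁
  p₂ : G₂ ⟶ G₁
  m : G₂ ⟶ G₁
  isPullback : IsPullback p₁ p₂ c d
  e_d : e ≫ d = 𝟙 G₀
  e_c : e ≫ c = 𝟙 G₀
  m_d : m ≫ d = p₁ ≫ d
  m_c : m ≫ c = p₂ ≫ c
  σ_d : σ ≫ d = c
  σ_c : σ ≫ c = d
  m_right_unit : isPullback.lift (𝟙 G₁) (c ≫ e) (by simp [e_d]) ≫ m = 𝟙 G₁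
  m_left_unit : isPullback.lift (d ≫ e) (𝟙 G₁) (by simp [e_c]) ≫ m = 𝟙 G₁
  m_assoc : ∀ {T : C} (x y z : T ⟶ G₁) (hxy : x ≫ c = y ≫ d) (hyz : y ≫ c = z ≫ d),
    isPullback.lift x (isPullback.lift y z hyz ≫ m) (by simp [m_d, hxy]) ≫ m =
      isPullback.lift (isPullback.lift x y hxy ≫ m) z (by simp [m_c, hyz]) ≫ m
  m_right_inv : isPullback.lift (𝟙 G₁) σ (by simp [σ_d]) ≫ m = d ≫ e
  m_left_inv : isPullback.lift σ (𝟙 G₁) (by simp [σ_c]) ≫ m = c ≫ e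

namespace InternalGroupoid

variable {C : Type u₁} [Category.{v₁} C] {X : Type u₂} [Category.{v₂} X]

/-- An internal functor between internal groupoids. -/
@[ext]
structure Hom (G' G : InternalGroupoid C) where
  f₀ : G'.G₀ ⟶ G.G₀
  f₁ : G'.G₁ ⟶ G.G₁
  f₂ : G'.G₂ ⟶ G.G₂
  w_d : G'.d ≫ f₀ = f₁ ≫ G.d
  w_c : G'.c ≫ f₀ = f₁ ≫ G.c
  w_e : G'.e ≫ f₁ = f₀ ≫ G.e
  w_p₁ : G'.p₁ ≫ f₁ = f₂ ≫ G.p₁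
  w_p₂ : G'.p₂ ≫ f₁ = f₂ ≫ G.p₂
  w_m : G'.m ≫ f₁ = f₂ ≫ G.m

/-- The category `Gpd(C)` of internal groupoids and internal functors. -/
instance : Category.{v₁} (InternalGroupoid C) where
  Hom G' G := Hom G' G
  id G :=
    { f₀ := 𝟙 _, f₁ := 𝟙 _, f₂ := 𝟙 _
      w_d := by simp, w_c := by simp, w_e := by simp
      w_p₁ := by simp, w_p₂ := by simp, w_m := by simp }
  comp f g :=
    { f₀ := f.f₀ ≫ g.f₀, f₁ := f.f₁ ≫ g.f₁, f₂ := f.f₂ ≫ g.f₂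
      w_d := by rw [← Category.assoc, f.w_d, Category.assoc, g.w_d, Category.assoc]
      w_c := by rw [← Category.assoc, f.w_c, Category.assoc, g.w_c, Category.assoc]
      w_e := by rw [← Category.assoc, f.w_e, Category.assoc, g.w_e, Category.assoc]
      w_p₁ := by rw [← Category.assoc, f.w_p₁, Category.assoc, g.w_p₁, Category.assoc]
      w_p₂ := by rw [← Category.assoc, f.w_p₂, Category.assoc, g.w_p₂, Category.assoc]
      w_m := by rw [← Category.assoc, f.w_m, Category.assoc, g.w_m, Category.assoc] }
  id_comp f := by apply Hom.ext <;> exact Category.id_comp _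
  comp_id f := by apply Hom.ext <;> exact Category.comp_id _
  assoc f g h := by apply Hom.ext <;> exact Category.assoc _ _ _

/-- An internal functor is a discrete fibration if all its commutative squares (for `d`, `c`, `e`,
`p₁`, `p₂` and `m`) are pullbacks. -/
structure IsDiscreteFibration {G' G : InternalGroupoid C} (f : G' ⟶ G) : Prop where
  d : IsPullback G'.d (Hom.f₁ f) (Hom.f₀ f) G.d
  c : IsPullback G'.c (Hom.f₁ f) (Hom.f₀ f) G.c
  e : IsPullback G'.e (Hom.f₀ f) (Hom.f₁ f) G.e
  p₁ : IsPullback G'.p₁ (Hom.f₂ f) (Hom.f₁ f) G.p₁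
  p₂ : IsPullback G'.p₂ (Hom.f₂ f) (Hom.f₁ f) G.p₂
  m : IsPullback G'.m (Hom.f₂ f) (Hom.f₁ f) G.m

/-- The discrete fibrations over `G` whose three components lie in the class `P`. -/
def discreteFibrations (P : MorphismProperty C) (G : InternalGroupoid C) :
    ObjectProperty (Over G) :=
  fun f => IsDiscreteFibration f.hom ∧
    P (Hom.f₀ f.hom) ∧ P (Hom.f₁ f.hom) ∧ P (Hom.f₂ f.hom)

/-- The category `C^{↓_P G}` of discrete fibrations over `G` with components in `P`, as a full
subcategory of the comma category `Gpd(C) ↓ G`. -/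
abbrev DiscFib (P : MorphismProperty C) (G : InternalGroupoid C) :=
  (discreteFibrations P G).FullSubcategory

/-- Composition of the equivalence relation given by the kernel pair of `p`: the pair of `(x, y)`
and `(y, z)` is sent to `(x, z)`. -/
noncomputable def kernelPairComp {A B : C} (p : A ⟶ B) [HasPullback p p]
    [HasPullback (pullback.snd p p) (pullback.fst p p)] :
    pullback (pullback.snd p p) (pullback.fst p p) ⟶ pullback p p :=
  pullback.lift (pullback.fst _ _ ≫ pullback.fst p p) (pullback.snd _ _ ≫ pullback.snd p p)
    (by rw [Category.assoc, pullback.condition, ← Category.assoc, pullback.condition,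
          Category.assoc, pullback.condition, Category.assoc])

theorem kernelPairComp_fst {A B : C} (p : A ⟶ B) [HasPullback p p]
    [HasPullback (pullback.snd p p) (pullback.fst p p)] :
    kernelPairComp p ≫ pullback.fst p p = pullback.fst _ _ ≫ pullback.fst p p :=
  pullback.lift_fst _ _ _

theorem kernelPairComp_snd {A B : C} (p : A ⟶ B) [HasPullback p p]
    [HasPullback (pullback.snd p p) (pullback.fst p p)] :
    kernelPairComp p ≫ pullback.snd p p = pullback.snd _ _ ≫ pullback.snd p p :=
  pullback.lift_snd _ _ _

theorem lift_kernelPairComp {A B : C} (p : A ⟶ B) [HasPullback p p]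
    [HasPullback (pullback.snd p p) (pullback.fst p p)] {T : C} (x y : T ⟶ pullback p p)
    (h : x ≫ pullback.snd p p = y ≫ pullback.fst p p) (z : T ⟶ pullback p p)
    (h₁ : z ≫ pullback.fst p p = x ≫ pullback.fst p p)
    (h₂ : z ≫ pullback.snd p p = y ≫ pullback.snd p p) :
    (IsPullback.of_hasPullback (pullback.snd p p) (pullback.fst p p)).lift x y h ≫
      kernelPairComp p = z := by
  apply pullback.hom_ext
  · rw [Category.assoc, kernelPairComp_fst, IsPullback.lift_fst_assoc, h₁]
  · rw [Category.assoc, kernelPairComp_snd, IsPullback.lift_snd_assoc, h₂]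

/-- The kernel pair `Eq(p)` of a morphism, as an internal groupoid: an arrow is a pair
`(x, y)` with `p x = p y`, and the composite of `(x, y)` and `(y, z)` is `(x, z)`. -/
noncomputable def kernelPair {A B : C} (p : A ⟶ B) [HasPullback p p]
    [HasPullback (pullback.snd p p) (pullback.fst p p)] : InternalGroupoid C where
  G₀ := A
  G₁ := pullback p p
  G₂ := pullback (pullback.snd p p) (pullback.fst p p)
  d := pullback.fst p p
  c := pullback.snd p p
  e := pullback.lift (𝟙 A) (𝟙 A) rfl
  σ := pullback.lift (pullback.snd p p) (pullback.fst p p) pullback.condition.symm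
  p₁ := pullback.fst _ _
  p₂ := pullback.snd _ _
  m := kernelPairComp p
  isPullback := IsPullback.of_hasPullback _ _
  e_d := pullback.lift_fst _ _ _
  e_c := pullback.lift_snd _ _ _
  m_d := kernelPairComp_fst p
  m_c := kernelPairComp_snd p
  σ_d := pullback.lift_fst _ _ _
  σ_c := pullback.lift_snd _ _ _
  m_right_unit := lift_kernelPairComp p _ _ _ _ rfl
    ((Category.id_comp _).trans (by
      rw [Category.assoc, pullback.lift_snd, Category.comp_id]))
  m_left_unit := lift_kernelPairComp p _ _ _ _
    ((Category.id_comp _).trans (by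
      rw [Category.assoc, pullback.lift_fst, Category.comp_id])) rfl
  m_assoc x y z hxy hyz := lift_kernelPairComp p _ _ _ _
    (by
      rw [Category.assoc, kernelPairComp_fst, IsPullback.lift_fst_assoc,
        Category.assoc, kernelPairComp_fst, IsPullback.lift_fst_assoc])
    (by
      simp only [Category.assoc, kernelPairComp_snd, IsPullback.lift_snd_assoc])
  m_right_inv := lift_kernelPairComp p _ _ _ _
    (by rw [Category.assoc, pullback.lift_fst, Category.comp_id, Category.id_comp])
    (by rw [Category.assoc, pullback.lift_snd, Category.comp_id, pullback.lift_snd])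
  m_left_inv := lift_kernelPairComp p _ _ _ _
    (by rw [Category.assoc, pullback.lift_fst, Category.comp_id, pullback.lift_fst])
    (by rw [Category.assoc, pullback.lift_snd, Category.comp_id, Category.id_comp])

theorem map_lift (K : C ⥤ X) (G : InternalGroupoid C)
    (h₂ : IsPullback (K.map G.p₁) (K.map G.p₂) (K.map G.c) (K.map G.d)) {T : C} (x y : T ⟶ G.G₁)
    (h : x ≫ G.c = y ≫ G.d) (x' y' : K.obj T ⟶ K.obj G.G₁) (hx : K.map x = x')
    (hy : K.map y = y') (h' : x' ≫ K.map G.c = y' ≫ K.map G.d) :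
    h₂.lift x' y' h' ≫ K.map G.m = K.map (G.isPullback.lift x y h ≫ G.m) := by
  rw [K.map_comp]
  congr 1
  subst hx hy
  apply h₂.hom_ext <;> simp [← K.map_comp]

/-- The image of an internal groupoid under a functor that preserves the pullback defining the
object of composable pairs and a pullback defining the object of composable triples. -/
def map (K : C ⥤ X) (G : InternalGroupoid C)
    (h₂ : IsPullback (K.map G.p₁) (K.map G.p₂) (K.map G.c) (K.map G.d))
    (h₃ : ∃ (G₃ : C) (q₁ q₂ : G₃ ⟶ G.G₂), IsPullback q₁ q₂ G.p₂ G.p₁ ∧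
      IsPullback (K.map q₁) (K.map q₂) (K.map G.p₂) (K.map G.p₁)) : InternalGroupoid X where
  G₀ := K.obj G.G₀
  G₁ := K.obj G.G₁
  G₂ := K.obj G.G₂
  d := K.map G.d
  c := K.map G.c
  e := K.map G.e
  σ := K.map G.σ
  p₁ := K.map G.p₁
  p₂ := K.map G.p₂
  m := K.map G.m
  isPullback := h₂
  e_d := by rw [← K.map_comp, G.e_d, K.map_id]
  e_c := by rw [← K.map_comp, G.e_c, K.map_id]
  m_d := by rw [← K.map_comp, G.m_d, K.map_comp]
  m_c := by rw [← K.map_comp, G.m_c, K.map_comp]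
  σ_d := by rw [← K.map_comp, G.σ_d]
  σ_c := by rw [← K.map_comp, G.σ_c]
  m_right_unit := (map_lift K G h₂ _ _ _ _ _ (K.map_id _) (K.map_comp _ _) _).trans
    ((congrArg K.map G.m_right_unit).trans (K.map_id _))
  m_left_unit := (map_lift K G h₂ _ _ _ _ _ (K.map_comp _ _) (K.map_id _) _).trans
    ((congrArg K.map G.m_left_unit).trans (K.map_id _))
  m_right_inv := (map_lift K G h₂ _ _ _ _ _ (K.map_id _) rfl _).trans
    ((congrArg K.map G.m_right_inv).trans (K.map_comp _ _))
  m_left_inv := (map_lift K G h₂ _ _ _ _ _ rfl (K.map_id _) _).trans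
    ((congrArg K.map G.m_left_inv).trans (K.map_comp _ _))
  m_assoc {T} x y z hxy hyz := by
    obtain ⟨G₃, q₁, q₂, hq, hKq⟩ := h₃
    have hm : (q₁ ≫ G.m) ≫ G.c = (q₂ ≫ G.p₂) ≫ G.d := by
      rw [Category.assoc, G.m_c, ← Category.assoc, hq.w, Category.assoc, Category.assoc,
        G.isPullback.w]
    have hm' : (q₁ ≫ G.p₁) ≫ G.c = (q₂ ≫ G.m) ≫ G.d := by
      rw [Category.assoc, Category.assoc, G.m_d, G.isPullback.w, ← Category.assoc, hq.w,
        Category.assoc]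
    have key : G.isPullback.lift (q₁ ≫ G.p₁) (q₂ ≫ G.m) hm' ≫ G.m =
        G.isPullback.lift (q₁ ≫ G.m) (q₂ ≫ G.p₂) hm ≫ G.m := by
      have h := G.m_assoc (q₁ ≫ G.p₁) (q₁ ≫ G.p₂) (q₂ ≫ G.p₂)
        (by simp [G.isPullback.w])
        (by rw [hq.w, Category.assoc, Category.assoc, G.isPullback.w])
      have a₁ : G.isPullback.lift (q₁ ≫ G.p₂) (q₂ ≫ G.p₂)
          (by rw [hq.w, Category.assoc, Category.assoc, G.isPullback.w]) = q₂ := by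
        apply G.isPullback.hom_ext <;> simp [hq.w]
      have a₂ : G.isPullback.lift (q₁ ≫ G.p₁) (q₁ ≫ G.p₂)
          (by simp [G.isPullback.w]) = q₁ := by
        apply G.isPullback.hom_ext <;> simp
      simpa only [a₁, a₂] using h
    set t : T ⟶ K.obj G₃ := hKq.lift (h₂.lift x y hxy) (h₂.lift y z hyz) (by simp) with ht
    have t₁ : t ≫ K.map q₁ = h₂.lift x y hxy := by simp [ht]
    have t₂ : t ≫ K.map q₂ = h₂.lift y z hyz := by simp [ht]
    have key' := congrArg (fun k => t ≫ K.map k) key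
    simp only [K.map_comp, ← Category.assoc] at key'
    convert key' using 2
    · apply h₂.hom_ext
      · rw [h₂.lift_fst, Category.assoc, ← K.map_comp, G.isPullback.lift_fst, K.map_comp,
          ← Category.assoc, t₁, h₂.lift_fst]
      · rw [h₂.lift_snd, Category.assoc, ← K.map_comp, G.isPullback.lift_snd, K.map_comp,
          ← Category.assoc, t₂]
    · apply h₂.hom_ext
      · rw [h₂.lift_fst, Category.assoc, ← K.map_comp, G.isPullback.lift_fst, K.map_comp,
          ← Category.assoc, t₁]
      · rw [h₂.lift_snd, Category.assoc, ← K.map_comp, G.isPullback.lift_snd, K.map_comp,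
          ← Category.assoc, t₂, h₂.lift_snd]

end InternalGroupoid

namespace GaloisStructure

variable {C : Type u₁} [Category.{v₁} C] {X : Type u₂} [Category.{v₂} X]

theorem hasPullback_kernelPair (Γ : GaloisStructure C X) {A B : C} {p : A ⟶ B} (hp : Γ.E p) :
    HasPullback p p :=
  Γ.E.hasPullback p hp

theorem E_fst (Γ : GaloisStructure C X) {A B : C} {p : A ⟶ B} (hp : Γ.E p)
    [HasPullback p p] : Γ.E (pullback.fst p p) :=
  Γ.E.of_isPullback (IsPullback.of_hasPullback p p).flip hp

theorem E_snd (Γ : GaloisStructure C X) {A B : C} {p : A ⟶ B} (hp : Γ.E p)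
    [HasPullback p p] : Γ.E (pullback.snd p p) :=
  Γ.E.of_isPullback (IsPullback.of_hasPullback p p) hp

/-- The internal groupoid `Eq(p)` of an extension `p`. -/
noncomputable def kernelGroupoid (Γ : GaloisStructure C X) {A B : C} (p : A ⟶ B) (hp : Γ.E p) :
    InternalGroupoid C :=
  haveI := Γ.hasPullback_kernelPair hp
  haveI := Γ.E.hasPullback (pullback.fst p p) (Γ.E_snd hp)
  InternalGroupoid.kernelPair p

/-- The Galois groupoid `Gal_Γ(A, p) = I(Eq(p))` of an extension `p : A ⟶ B`. -/
noncomputable def galoisGroupoid (Γ : GaloisStructure C X) (hΓ : Γ.PreservesSplitPullbacks)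
    {A B : C} (p : A ⟶ B) (hp : Γ.E p) : InternalGroupoid X :=
  InternalGroupoid.map Γ.I (Γ.kernelGroupoid p hp)
    (by
      let G := Γ.kernelGroupoid p hp
      have := Γ.hasPullback_kernelPair hp
      have hd : Γ.E G.d := Γ.E_fst hp
      have hc : Γ.E G.c := Γ.E_snd hp
      exact hΓ _ _ _ _ G.isPullback (IsSplitEpi.mk' ⟨G.e, G.e_c⟩) hc hd)
    (by
      let G := Γ.kernelGroupoid p hp
      have := Γ.hasPullback_kernelPair hp
      have hd : Γ.E G.d := Γ.E_fst hp
      have hc : Γ.E G.c := Γ.E_snd hp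
      have h₁ : Γ.E G.p₁ := Γ.E.of_isPullback G.isPullback.flip hd
      have h₂ : Γ.E G.p₂ := Γ.E.of_isPullback G.isPullback hc
      have s₂ : IsSplitEpi G.p₂ :=
        isSplitEpi_of_isPullback G.isPullback (IsSplitEpi.mk' ⟨G.e, G.e_c⟩)
      have := Γ.E.hasPullback G.p₁ h₂
      exact ⟨_, _, _, IsPullback.of_hasPullback G.p₂ G.p₁,
        hΓ _ _ _ _ (IsPullback.of_hasPullback G.p₂ G.p₁) s₂ h₂ h₁⟩)

end GaloisStructure

/-! Let `p : P ⟶ B` be monadic. Algebras for the monad of `p^*` are extensions of `P` with an action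
of `Eq(p)`, so an extension `f` of `B` amounts to `p^*(f)` with its canonical action, that is, to
the discrete fibration `Eq(q) ⟶ Eq(p)`, where `q` is the pullback of `p` along `f`. When `p^*(f)` is
a split epimorphism, the preservation hypothesis makes the image under `I` a discrete fibration over
the Galois groupoid; this defines `toDiscFib`.

Nothing is lost if `p^*(f)` is also trivial: a morphism into a trivial extension is the same as its
composite to the base together with a compatible image under `I` (`IsTrivialExtension.hom_ext`,
`IsTrivialExtension.exists_lift`). Morphisms can therefore be constructed, and equations checked,
after applying `I`; with descent for morphisms this gives full faithfulness. For essential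
surjectivity, admissibility realises the object part of a discrete fibration as `I(π)` for a split
trivial extension `π` of `P` (`isTrivialExtension_of_isPullback`), and `exists_action` transfers the
action to `π`, which then descends to `B`.

For the comparison with normal extensions, a section of `p^*(f)` factors `p` through `f`. Hence `f`
is monadic (`IsMonadicExtension.of_comp`), and triviality of `f^*(f)` descends from its pullback
along `q` (`isTrivialExtension_of_pullback`). Conversely, if `p` factors through a normal `f`, then
`p^*(f)` is a base change of `f^*(f)`, hence trivial and split. Weak universality supplies these
factorizations. -/

namespace InternalGroupoid

variable {C : Type u₁} [Category.{v₁} C] {X : Type u₂} [Category.{v₂} X]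

/-! ### Discrete fibrations and their morphisms. -/

theorem isPullback_p₁_of_isPullback_d {G' G : InternalGroupoid C} {f : G' ⟶ G}
    (hd : IsPullback G'.d (Hom.f₁ f) (Hom.f₀ f) G.d) :
    IsPullback G'.p₁ (Hom.f₂ f) (Hom.f₁ f) G.p₁ := by
  refine IsPullback.of_bot (v₂₁ := G.p₂) (v₂₂ := G.c) (h₃₁ := G.d) ?_ f.w_p₁ G.isPullback
  rw [← f.w_p₂, ← f.w_c]
  exact G'.isPullback.paste_vert hd

/-- An internal functor is a discrete fibration as soon as its squares for `d` and `c` are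
pullbacks. -/
theorem IsDiscreteFibration.of_isPullback {G' G : InternalGroupoid C} {f : G' ⟶ G}
    (hd : IsPullback G'.d (Hom.f₁ f) (Hom.f₀ f) G.d)
    (hc : IsPullback G'.c (Hom.f₁ f) (Hom.f₀ f) G.c) : IsDiscreteFibration f where
  d := hd
  c := hc
  e := by
    -- Pasted with the square of `d`, the unit square becomes a square with identity horizontals, so
    -- it is a pullback by cancellation. The square of `m` below is treated alike, since `m ≫ d = p₁
    -- ≫ d`.
    refine IsPullback.of_right (h₁₂ := G'.d) (h₂₂ := G.d) (v₁₃ := Hom.f₀ f) ?_ f.w_e hd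
    rw [G'.e_d, G.e_d]
    exact IsPullback.of_horiz_isIso ⟨by simp⟩
  p₁ := isPullback_p₁_of_isPullback_d hd
  p₂ := by
    refine IsPullback.of_bot (v₂₁ := G.p₁) (v₂₂ := G.d) (h₃₁ := G.c) ?_ f.w_p₂ G.isPullback.flip
    rw [← f.w_p₁, ← f.w_d]
    exact G'.isPullback.flip.paste_vert hc
  m := by
    refine IsPullback.of_right (h₁₂ := G'.d) (h₂₂ := G.d) (v₁₃ := Hom.f₀ f) ?_ f.w_m hd
    rw [G'.m_d, G.m_d]
    exact (isPullback_p₁_of_isPullback_d hd).paste_horiz hd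

namespace DiscFib

variable {P : MorphismProperty C} {G : InternalGroupoid C}

/-- The object component of a morphism of discrete fibrations. -/
abbrev homObj {A B : DiscFib P G} (f : A ⟶ B) : A.obj.left.G₀ ⟶ B.obj.left.G₀ :=
  Hom.f₀ f.hom.left

/-- The arrow component of a morphism of discrete fibrations. -/
abbrev homArr {A B : DiscFib P G} (f : A ⟶ B) : A.obj.left.G₁ ⟶ B.obj.left.G₁ :=
  Hom.f₁ f.hom.left

theorem homObj_comp {A B : DiscFib P G} (f : A ⟶ B) :
    homObj f ≫ Hom.f₀ B.obj.hom = Hom.f₀ A.obj.hom :=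
  congrArg Hom.f₀ (Over.w f.hom)

theorem homArr_comp {A B : DiscFib P G} (f : A ⟶ B) :
    homArr f ≫ Hom.f₁ B.obj.hom = Hom.f₁ A.obj.hom :=
  congrArg Hom.f₁ (Over.w f.hom)

/-- Uniqueness of arrow lifting. Because of it, compatibility with units and composition is
automatic for maps that respect `d` and `c` over `G`. -/
theorem arr_hom_ext (B : DiscFib P G) {T : C} {x y : T ⟶ B.obj.left.G₁}
    (hd : x ≫ B.obj.left.d = y ≫ B.obj.left.d)
    (h : x ≫ Hom.f₁ B.obj.hom = y ≫ Hom.f₁ B.obj.hom) : x = y :=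
  B.property.1.d.hom_ext hd h

/-- A morphism of discrete fibrations over `G` is determined by its action on objects. -/
theorem hom_ext {A B : DiscFib P G} {f g : A ⟶ B} (h : homObj f = homObj g) : f = g := by
  have h₁ : homArr f = homArr g := by
    apply arr_hom_ext B
    · rw [← Hom.w_d, ← Hom.w_d]
      exact congrArg _ h
    · rw [homArr_comp, homArr_comp]
  apply ObjectProperty.hom_ext
  apply Over.OverMorphism.ext
  apply Hom.ext
  · exact h
  · exact h₁
  · apply B.obj.left.isPullback.hom_ext
    · rw [← Hom.w_p₁, ← Hom.w_p₁]
      exact congrArg _ h₁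
    · rw [← Hom.w_p₂, ← Hom.w_p₂]
      exact congrArg _ h₁

section

variable {A B : DiscFib P G} (h₀ : A.obj.left.G₀ ⟶ B.obj.left.G₀)
  (h₁ : A.obj.left.G₁ ⟶ B.obj.left.G₁) (w₀ : h₀ ≫ Hom.f₀ B.obj.hom = Hom.f₀ A.obj.hom)
  (w₁ : h₁ ≫ Hom.f₁ B.obj.hom = Hom.f₁ A.obj.hom)
  (wd : A.obj.left.d ≫ h₀ = h₁ ≫ B.obj.left.d) (wc : A.obj.left.c ≫ h₀ = h₁ ≫ B.obj.left.c)

/-- A morphism of discrete fibrations, from its components on objects and on arrows. -/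
noncomputable def homMk : A ⟶ B :=
  have hp : (A.obj.left.p₁ ≫ h₁) ≫ B.obj.left.c = (A.obj.left.p₂ ≫ h₁) ≫ B.obj.left.d := by
    simp only [Category.assoc, ← wd, ← wc, A.obj.left.isPullback.w_assoc]
  let k : Hom A.obj.left B.obj.left :=
    { f₀ := h₀
      f₁ := h₁
      f₂ := B.obj.left.isPullback.lift (A.obj.left.p₁ ≫ h₁) (A.obj.left.p₂ ≫ h₁) hp
      w_d := wd
      w_c := wc
      w_e := by
        apply arr_hom_ext B
        · simp only [Category.assoc, ← wd, B.obj.left.e_d, Category.comp_id]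
          rw [← Category.assoc, A.obj.left.e_d, Category.id_comp]
        · rw [Category.assoc, w₁, Category.assoc, Hom.w_e, Hom.w_e, ← Category.assoc, w₀]
      w_p₁ := by simp
      w_p₂ := by simp
      w_m := by
        apply arr_hom_ext B
        · simp only [Category.assoc, ← wd, B.obj.left.m_d, IsPullback.lift_fst_assoc]
          rw [← Category.assoc, A.obj.left.m_d, Category.assoc]
        · rw [Category.assoc, w₁, Category.assoc, Hom.w_m, Hom.w_m, ← Category.assoc]
          congr 1
          apply G.isPullback.hom_ext
          · simp only [Category.assoc, ← Hom.w_p₁, IsPullback.lift_fst_assoc, w₁]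
          · simp only [Category.assoc, ← Hom.w_p₂, IsPullback.lift_snd_assoc, w₁] }
  have hk : k.f₂ ≫ Hom.f₂ B.obj.hom = Hom.f₂ A.obj.hom := by
    apply G.isPullback.hom_ext
    · rw [Category.assoc, ← Hom.w_p₁, ← Hom.w_p₁, ← Category.assoc, ← k.w_p₁, Category.assoc, w₁]
    · rw [Category.assoc, ← Hom.w_p₂, ← Hom.w_p₂, ← Category.assoc, ← k.w_p₂, Category.assoc, w₁]
  ObjectProperty.homMk (Over.homMk (U := A.obj) (V := B.obj) k (Hom.ext w₀ w₁ hk))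

include w₀ w₁ wd wc in
/-- A morphism of discrete fibrations that is invertible on objects is invertible. -/
theorem nonempty_iso (hi : IsIso h₀) : Nonempty (A ≅ B) := by
  have hk : (B.obj.left.d ≫ inv h₀) ≫ Hom.f₀ A.obj.hom = Hom.f₁ B.obj.hom ≫ G.d := by
    rw [← w₀, Category.assoc, IsIso.inv_hom_id_assoc, Hom.w_d]
  -- The inverse on arrows: lift the image in `G` of an arrow of `B`, starting at its source
  -- transported by `inv h₀`.
  let k : B.obj.left.G₁ ⟶ A.obj.left.G₁ := A.property.1.d.lift _ _ hk
  have kd : k ≫ A.obj.left.d = B.obj.left.d ≫ inv h₀ := A.property.1.d.lift_fst _ _ _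
  have kf : k ≫ Hom.f₁ A.obj.hom = Hom.f₁ B.obj.hom := A.property.1.d.lift_snd _ _ _
  have kh : k ≫ h₁ = 𝟙 _ := by
    apply arr_hom_ext B
    · rw [Category.assoc, ← wd, ← Category.assoc, kd]
      simp
    · rw [Category.assoc, w₁, kf, Category.id_comp]
  refine ⟨⟨homMk h₀ h₁ w₀ w₁ wd wc, homMk (inv h₀) k (by simp [← w₀]) kf kd.symm ?_, ?_, ?_⟩⟩
  · rw [← cancel_mono h₀, Category.assoc, IsIso.inv_hom_id, Category.assoc, wc, ← Category.assoc,
      kh, Category.id_comp, Category.comp_id]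
  · exact hom_ext (IsIso.hom_inv_id h₀)
  · exact hom_ext (IsIso.inv_hom_id h₀)

end

end DiscFib

/-- The image of an internal functor under a functor. -/
def mapHom (K : C ⥤ X) {G' G : InternalGroupoid C} (f : G' ⟶ G) (h₂' h₃' h₂ h₃) :
    map K G' h₂' h₃' ⟶ map K G h₂ h₃ :=
  { f₀ := K.map (Hom.f₀ f)
    f₁ := K.map (Hom.f₁ f)
    f₂ := K.map (Hom.f₂ f)
    w_d := by simp only [map, ← K.map_comp, Hom.w_d]
    w_c := by simp only [map, ← K.map_comp, Hom.w_c]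
    w_e := by simp only [map, ← K.map_comp, Hom.w_e]
    w_p₁ := by simp only [map, ← K.map_comp, Hom.w_p₁]
    w_p₂ := by simp only [map, ← K.map_comp, Hom.w_p₂]
    w_m := by simp only [map, ← K.map_comp, Hom.w_m] : Hom _ _ }

/-! ### Functoriality of kernel pair groupoids. -/

section

variable {A B A' B' : C} {p : A ⟶ B} {q : A' ⟶ B'} [HasPullback p p]
  [HasPullback q q] (f : A ⟶ A') (g : B ⟶ B') (w : p ≫ g = f ≫ q)

/-- The morphism between kernel pairs induced by a commutative square. -/
noncomputable def kernelPairArr : pullback p p ⟶ pullback q q :=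
  pullback.lift (pullback.fst p p ≫ f) (pullback.snd p p ≫ f)
    (by simp only [Category.assoc, ← w, pullback.condition_assoc])

@[simp]
theorem kernelPairArr_fst : kernelPairArr f g w ≫ pullback.fst q q = pullback.fst p p ≫ f :=
  pullback.lift_fst _ _ _

@[simp]
theorem kernelPairArr_snd : kernelPairArr f g w ≫ pullback.snd q q = pullback.snd p p ≫ f :=
  pullback.lift_snd _ _ _

variable [HasPullback (pullback.snd p p) (pullback.fst p p)]
  [HasPullback (pullback.snd q q) (pullback.fst q q)]

/-- The morphism between objects of composable pairs induced by a commutative square. -/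
noncomputable def kernelPairPair : pullback (pullback.snd p p) (pullback.fst p p) ⟶
    pullback (pullback.snd q q) (pullback.fst q q) :=
  pullback.lift (pullback.fst _ _ ≫ kernelPairArr f g w) (pullback.snd _ _ ≫ kernelPairArr f g w)
    (by simp [pullback.condition_assoc])

theorem kernelPairPair_fst : kernelPairPair f g w ≫ pullback.fst _ _ =
    pullback.fst _ _ ≫ kernelPairArr f g w :=
  pullback.lift_fst _ _ _

theorem kernelPairPair_snd : kernelPairPair f g w ≫ pullback.snd _ _ =
    pullback.snd _ _ ≫ kernelPairArr f g w :=
  pullback.lift_snd _ _ _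

theorem kernelPairPair_comp :
    kernelPairComp p ≫ kernelPairArr f g w = kernelPairPair f g w ≫ kernelPairComp q := by
  apply pullback.hom_ext <;>
    simp [kernelPairPair, kernelPairComp, pullback.lift_fst, pullback.lift_snd,
      pullback.lift_fst_assoc, pullback.lift_snd_assoc]

/-- The internal functor between kernel pairs induced by a commutative square. -/
noncomputable def kernelPairHom : kernelPair p ⟶ kernelPair q :=
  have he : pullback.lift (𝟙 A) (𝟙 A) rfl ≫ kernelPairArr f g w =
      f ≫ pullback.lift (𝟙 A') (𝟙 A') rfl := by
    apply pullback.hom_ext <;> simp [pullback.lift_fst, pullback.lift_snd,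
      pullback.lift_fst_assoc, pullback.lift_snd_assoc]
  { f₀ := f
    f₁ := kernelPairArr f g w
    f₂ := kernelPairPair f g w
    w_d := (kernelPairArr_fst f g w).symm
    w_c := (kernelPairArr_snd f g w).symm
    w_e := he
    w_p₁ := (kernelPairPair_fst f g w).symm
    w_p₂ := (kernelPairPair_snd f g w).symm
    w_m := kernelPairPair_comp f g w : Hom (kernelPair p) (kernelPair q) }

end

end InternalGroupoid

/-! ### Base change functors and their underlying morphisms. -/

theorem isIso_of_isPullback_of_isPullback {C : Type u₁} [Category.{v₁} C] {P P' A B D : C}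
    {a : P ⟶ A} {b : P ⟶ B} {a' : P' ⟶ A} {b' : P' ⟶ B} {f : A ⟶ D} {g : B ⟶ D}
    (h : IsPullback a b f g) (h' : IsPullback a' b' f g) {m : P ⟶ P'} (ha : m ≫ a' = a)
    (hb : m ≫ b' = b) : IsIso m := by
  have : m = (h.isoIsPullback _ _ h').hom := by
    apply h'.hom_ext <;> simp [ha, hb]
  rw [this]
  infer_instance

section

variable {C : Type u₁} [Category.{v₁} C] {E : MorphismProperty C} {A B : C}

theorem isIso_left {f g : E.Over ⊤ B} (k : f ⟶ g) [IsIso k] : IsIso k.left :=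
  inferInstanceAs (IsIso ((MorphismProperty.Over.forget E ⊤ B ⋙ Over.forget B).map k))

theorem isIso_of_isIso_left {f g : E.Over ⊤ B} (k : f ⟶ g) [IsIso k.left] : IsIso k := by
  have : k = (MorphismProperty.Over.isoMk (asIso k.left) (MorphismProperty.Over.w k)).hom :=
    MorphismProperty.Over.Hom.ext rfl
  rw [this]
  infer_instance

variable [E.IsStableUnderBaseChange] [E.HasPullbacks]

/-- The underlying morphism of `p^*(k)`. -/
noncomputable def pullbackMap (p : A ⟶ B) {f g : E.Over ⊤ B} (k : f ⟶ g) :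
    pullback f.hom p ⟶ pullback g.hom p :=
  ((MorphismProperty.Over.pullback E ⊤ p).map k).left

theorem pullbackMap_fst (p : A ⟶ B) {f g : E.Over ⊤ B} (k : f ⟶ g) :
    pullbackMap p k ≫ pullback.fst g.hom p = pullback.fst f.hom p ≫ k.left :=
  pullback.lift_fst (C := C) _ _ _

theorem pullbackMap_snd (p : A ⟶ B) {f g : E.Over ⊤ B} (k : f ⟶ g) :
    pullbackMap p k ≫ pullback.snd g.hom p = pullback.snd f.hom p :=
  pullback.lift_snd (C := C) _ _ _

theorem isIso_map_of_isIso_pullbackMap (p : A ⟶ B) {f g : E.Over ⊤ B} (k : f ⟶ g)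
    (h : IsIso (pullbackMap p k)) : IsIso ((MorphismProperty.Over.pullback E ⊤ p).map k) :=
  have : IsIso ((MorphismProperty.Over.pullback E ⊤ p).map k).left := h
  isIso_of_isIso_left _

end

/-! ### Trivial extensions and admissibility. -/

namespace GaloisStructure

variable {C : Type u₁} [Category.{v₁} C] {X : Type u₂} [Category.{v₂} X]
  (Γ : GaloisStructure C X)

/-- The component `A ⟶ H(I(A))` of the unit. -/
def unit (A : C) : A ⟶ Γ.H.obj (Γ.I.obj A) := Γ.adj.unit.app A

theorem unit_naturality {A B : C} (f : A ⟶ B) :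
    f ≫ Γ.unit B = Γ.unit A ≫ Γ.H.map (Γ.I.map f) :=
  Γ.adj.unit.naturality f

theorem hom_ext_of_unit_comp {A : C} {Y : X} {u v : Γ.I.obj A ⟶ Y}
    (h : Γ.unit A ≫ Γ.H.map u = Γ.unit A ≫ Γ.H.map v) : u = v :=
  (Γ.adj.homEquiv A Y).injective (by simpa only [Adjunction.homEquiv_unit] using! h)

theorem isPullback_map_H {A B D E : X} {a : A ⟶ B} {b : A ⟶ D} {f : B ⟶ E} {g : D ⟶ E}
    (h : IsPullback a b f g) :
    IsPullback (Γ.H.map a) (Γ.H.map b) (Γ.H.map f) (Γ.H.map g) :=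
  have := Γ.adj.rightAdjoint_preservesLimits
  h.map Γ.H

variable {Γ}

theorem IsTrivialExtension.isPullback {A B : C} {f : A ⟶ B} (hf : Γ.IsTrivialExtension f) :
    IsPullback (Γ.unit A) f (Γ.H.map (Γ.I.map f)) (Γ.unit B) :=
  hf.2

/-- Morphisms into a trivial extension `f : A ⟶ B` are determined by their composites with `f` and
by their images under `I`. -/
theorem IsTrivialExtension.hom_ext {A B T : C} {f : A ⟶ B} (hf : Γ.IsTrivialExtension f)
    {u v : T ⟶ A} (h : u ≫ f = v ≫ f) (hI : Γ.I.map u = Γ.I.map v) : u = v := by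
  apply hf.isPullback.hom_ext _ h
  rw [Γ.unit_naturality, Γ.unit_naturality, hI]

/-- Morphisms over `B` into a trivial extension of `B` lift morphisms over `I(B)`. -/
theorem IsTrivialExtension.exists_lift {A B T : C} {f : A ⟶ B} (hf : Γ.IsTrivialExtension f)
    (w : T ⟶ B) (k : Γ.I.obj T ⟶ Γ.I.obj A) (h : k ≫ Γ.I.map f = Γ.I.map w) :
    ∃ u : T ⟶ A, u ≫ f = w ∧ Γ.I.map u = k := by
  have hk : (Γ.unit T ≫ Γ.H.map k) ≫ Γ.H.map (Γ.I.map f) = w ≫ Γ.unit B := by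
    rw [Category.assoc, ← Γ.H.map_comp, h, Γ.unit_naturality]
  refine ⟨hf.isPullback.lift _ _ hk, hf.isPullback.lift_snd _ _ _, Γ.hom_ext_of_unit_comp ?_⟩
  rw [← Γ.unit_naturality, hf.isPullback.lift_fst]

section Admissible

variable (hadm : Γ.split.IsAdmissible) {B : C}

include hadm

/-- Fullness of `H^B`, freed from the chosen pullbacks so that it applies to any pullback squares.
-/
theorem exists_of_isAdmissible {Y Y' : X} {φ : Y ⟶ Γ.I.obj B} {φ' : Y' ⟶ Γ.I.obj B}
    (hφ : splitPart Γ.F φ) (hφ' : splitPart Γ.F φ') {A A' : C} {s : A ⟶ Γ.H.obj Y} {f : A ⟶ B}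
    {s' : A' ⟶ Γ.H.obj Y'} {f' : A' ⟶ B}
    (h : IsPullback s f (Γ.H.map φ) (Γ.unit B))
    (h' : IsPullback s' f' (Γ.H.map φ') (Γ.unit B)) (u : A ⟶ A') (hu : u ≫ f' = f) :
    ∃ v : Y ⟶ Y', v ≫ φ' = φ ∧ s ≫ Γ.H.map v = u ≫ s' := by
  have := (hadm B).1
  let y : Γ.split.F.Over ⊤ (Γ.I.obj B) := MorphismProperty.Over.mk ⊤ φ hφ
  let y' : Γ.split.F.Over ⊤ (Γ.I.obj B) := MorphismProperty.Over.mk ⊤ φ' hφ'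
  have : HasPullback (Γ.H.map φ) (Γ.unit B) := h.hasPullback
  have : HasPullback (Γ.H.map φ') (Γ.unit B) := h'.hasPullback
  let w : (Γ.split.inducedH B).obj y ⟶ (Γ.split.inducedH B).obj y' :=
    MorphismProperty.Over.homMk (h.isoPullback.inv ≫ u ≫ h'.isoPullback.hom)
      (by
        change (h.isoPullback.inv ≫ u ≫ h'.isoPullback.hom) ≫ pullback.snd _ _ =
          pullback.snd _ _
        simp [hu]) trivial
  obtain ⟨v, hv⟩ := (Γ.split.inducedH B).map_surjective w
  let v' : Y ⟶ Y' := v.left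
  refine ⟨v', MorphismProperty.Over.w v, ?_⟩
  have e : (h.isoPullback.inv ≫ u ≫ h'.isoPullback.hom) ≫ pullback.fst (Γ.H.map φ') (Γ.unit B) =
      pullback.fst (Γ.H.map φ) (Γ.unit B) ≫ Γ.H.map v' :=
    (congrArg (fun k => k.left ≫ pullback.fst (Γ.H.map φ') (Γ.unit B)) hv).symm.trans
      (pullbackMap_fst (Γ.unit B) ((Γ.split.overH _).map v))
  have e' := congrArg (h.isoPullback.hom ≫ ·) e
  simp only [Category.assoc, Iso.hom_inv_id_assoc, IsPullback.isoPullback_hom_fst,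
    IsPullback.isoPullback_hom_fst_assoc] at e'
  exact e'.symm

/-- Faithfulness of `H^B` for arbitrary pullback squares. Only the composites with `s` need
comparing, since the components over `B` agree automatically. -/
theorem hom_ext_of_isAdmissible {Y Y' : X} {φ : Y ⟶ Γ.I.obj B} {φ' : Y' ⟶ Γ.I.obj B}
    (hφ : splitPart Γ.F φ) (hφ' : splitPart Γ.F φ') {A : C} {s : A ⟶ Γ.H.obj Y} {f : A ⟶ B}
    (h : IsPullback s f (Γ.H.map φ) (Γ.unit B)) {v v' : Y ⟶ Y'} (hv : v ≫ φ' = φ)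
    (hv' : v' ≫ φ' = φ) (hs : s ≫ Γ.H.map v = s ≫ Γ.H.map v') : v = v' := by
  have := (hadm B).2
  let y : Γ.split.F.Over ⊤ (Γ.I.obj B) := MorphismProperty.Over.mk ⊤ φ hφ
  let y' : Γ.split.F.Over ⊤ (Γ.I.obj B) := MorphismProperty.Over.mk ⊤ φ' hφ'
  have : HasPullback (Γ.H.map φ) (Γ.unit B) := h.hasPullback
  let w : y ⟶ y' := MorphismProperty.Over.homMk v hv trivial
  let w' : y ⟶ y' := MorphismProperty.Over.homMk v' hv' trivial
  have e : pullback.fst (Γ.H.map φ) (Γ.unit B) ≫ Γ.H.map v =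
      pullback.fst _ _ ≫ Γ.H.map v' := by
    have := congrArg (h.isoPullback.inv ≫ ·) hs
    simpa using this
  have : w = w' := by
    apply (Γ.split.inducedH B).map_injective
    apply MorphismProperty.Over.Hom.ext
    have : HasPullback (Γ.H.map φ') (Γ.unit B) :=
      (splitPart Γ.E).hasPullback (Γ.unit B) (Γ.split.map_H _ hφ')
    apply pullback.hom_ext (f := Γ.H.map φ') (g := Γ.unit B)
    · exact (pullbackMap_fst (Γ.unit B) ((Γ.split.overH _).map w)).trans
        (e.trans (pullbackMap_fst (Γ.unit B) ((Γ.split.overH _).map w')).symm)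
    · exact (pullbackMap_snd (Γ.unit B) ((Γ.split.overH _).map w)).trans
        (pullbackMap_snd (Γ.unit B) ((Γ.split.overH _).map w')).symm
  exact congrArg (fun k => k.left) this

/-- If `Γ_Split` is admissible, then `H^B` sends `φ : Y ⟶ I(B)` in `Split(F)` to a trivial
extension whose image under `I` is isomorphic to `φ`. -/
theorem isTrivialExtension_of_isPullback {Y : X} {φ : Y ⟶ Γ.I.obj B} (hφ : splitPart Γ.F φ)
    {A : C} {s : A ⟶ Γ.H.obj Y} {f : A ⟶ B}
    (h : IsPullback s f (Γ.H.map φ) (Γ.unit B)) :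
    Γ.IsTrivialExtension f ∧ ∃ t : Γ.I.obj A ≅ Y, t.hom ≫ φ = Γ.I.map f := by
  have hf : splitPart Γ.E f := (splitPart Γ.E).of_isPullback h (Γ.split.map_H _ hφ)
  have hIf : splitPart Γ.F (Γ.I.map f) := Γ.split.map_I _ hf
  have : HasPullback (Γ.H.map (Γ.I.map f)) (Γ.unit B) :=
    (splitPart Γ.E).hasPullback _ (Γ.split.map_H _ hIf)
  have h' := IsPullback.of_hasPullback (Γ.H.map (Γ.I.map f)) (Γ.unit B)
  -- Fullness applied to the comparison of `f` with `H^B(I(f))` yields a candidate inverse `v` to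
  -- the transpose `t` of `s`. One composite is the identity by faithfulness, the other by the
  -- adjunction.
  obtain ⟨v, hv, hv'⟩ := exists_of_isAdmissible hadm hφ hIf h h'
    (h'.lift (Γ.unit A) f (Γ.unit_naturality f).symm) (h'.lift_snd _ _ _)
  rw [h'.lift_fst] at hv'
  let t : Γ.I.obj A ⟶ Y := (Γ.adj.homEquiv A Y).symm s
  have ht : Γ.unit A ≫ Γ.H.map t = s :=
    (Adjunction.homEquiv_unit _ _ _ _).symm.trans (Equiv.apply_symm_apply _ _)
  have htφ : t ≫ φ = Γ.I.map f := by
    apply Γ.hom_ext_of_unit_comp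
    rw [Γ.H.map_comp, ← Category.assoc, ht, h.w, Γ.unit_naturality]
  have hvt : v ≫ t = 𝟙 Y := by
    apply hom_ext_of_isAdmissible hadm hφ hφ h (by rw [Category.assoc, htφ, hv])
      (Category.id_comp _)
    rw [Γ.H.map_comp, ← Category.assoc, hv', ht, Γ.H.map_id, Category.comp_id]
  have htv : t ≫ v = 𝟙 _ := by
    apply Γ.hom_ext_of_unit_comp
    rw [Γ.H.map_comp, ← Category.assoc, ht, hv', Γ.H.map_id, Category.comp_id]
  let e : Γ.I.obj A ≅ Y := ⟨t, v, htv, hvt⟩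
  refine ⟨⟨hf.1, ?_⟩, e, htφ⟩
  change IsPullback (Γ.unit A) f (Γ.H.map (Γ.I.map f)) (Γ.unit B)
  refine h.of_iso (Iso.refl _) (Γ.H.mapIso e.symm) (Iso.refl _) (Iso.refl _) ?_ (by simp) ?_
    (by simp)
  · simp [e, hv']
  · simp [e, ← Γ.H.map_comp, hv]

/-- If `Γ_Split` is admissible, then trivial extensions that are split epimorphisms are stable
under pullback. -/
theorem IsTrivialExtension.of_isPullback {A D T : C} {f : A ⟶ B} (hf : Γ.IsTrivialExtension f)
    (hs : IsSplitEpi f) {k : D ⟶ A} {f' : D ⟶ T} {w : T ⟶ B} (h : IsPullback k f' f w) :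
    Γ.IsTrivialExtension f' := by
  have hIf : splitPart Γ.F (Γ.I.map f) := Γ.split.map_I _ ⟨hf.1, hs⟩
  have := Γ.F.hasPullback (Γ.I.map w) hIf.1
  have hY := IsPullback.of_hasPullback (Γ.I.map f) (Γ.I.map w)
  have := h.paste_horiz hf.isPullback
  -- The pullback of `H(I(f))` along `w ≫ unit B` is now one along `unit T ≫ H(I(w))`. This exhibits
  -- `f'` as `H^T` of the pullback of `I(f)` along `I(w)`, which is trivial by admissibility.
  rw [Γ.unit_naturality w] at this
  exact (isTrivialExtension_of_isPullback hadm ((splitPart Γ.F).of_isPullback hY hIf)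
    (IsPullback.of_right' this (Γ.isPullback_map_H hY))).1

end Admissible

/-- Triviality of a split extension `h` of `A` descends along an extension `q` such that `q^*`
reflects isomorphisms, if `I` preserves pullbacks of split extensions along extensions. -/
theorem isTrivialExtension_of_pullback (hΓ : Γ.PreservesSplitPullbacks) {A₀ A : C} {q : A₀ ⟶ A}
    (hq : Γ.E q) [(MorphismProperty.Over.pullback Γ.E ⊤ q).ReflectsIsomorphisms]
    (h : Γ.E.Over ⊤ A) (hs : IsSplitEpi h.hom) (h₀ : Γ.IsTrivialExtension (Γ.baseChange q h)) :
    Γ.IsTrivialExtension h.hom := by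
  have := Γ.E.hasPullback (Γ.unit A) (Γ.map_H _ (Γ.map_I _ h.prop))
  let D' : Γ.E.Over ⊤ A :=
    (MorphismProperty.Over.pullback Γ.E ⊤ (Γ.unit A)).obj
      (MorphismProperty.Over.mk ⊤ (Γ.H.map (Γ.I.map h.hom)) (Γ.map_H _ (Γ.map_I _ h.prop)))
  have hD' : IsPullback (pullback.fst (Γ.H.map (Γ.I.map h.hom)) (Γ.unit A)) D'.hom
    (Γ.H.map (Γ.I.map h.hom)) (Γ.unit A) := IsPullback.of_hasPullback _ _
  -- Triviality of `h` means that this comparison with the pullback of `H(I(h))` is invertible,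
  -- which may be tested after `q^*`.
  let δ : h ⟶ D' := MorphismProperty.Over.homMk
    (hD'.lift (Γ.unit _) h.hom (Γ.unit_naturality h.hom).symm) (hD'.lift_snd _ _ _) trivial
  have hδ : δ.left ≫ pullback.fst (Γ.H.map (Γ.I.map h.hom)) (Γ.unit A) =
    Γ.unit _ := hD'.lift_fst _ _ _
  have hδ' : δ.left ≫ D'.hom = h.hom := hD'.lift_snd _ _ _
  have hpb := IsPullback.of_hasPullback h.hom q
  -- Both `q^*(h)` and `q^*(D')` are pullbacks of `H(I(h))` along `q ≫ unit A`; for `q^*(h)` this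
  -- combines its triviality with preservation of the pullback by `I`.
  have h₁ := h₀.isPullback.paste_horiz (Γ.isPullback_map_H (hΓ _ _ _ _ hpb hs h.prop hq))
  rw [← Γ.unit_naturality, ← Γ.unit_naturality q] at h₁
  have h₂ := (IsPullback.of_hasPullback D'.hom q).paste_horiz hD'
  have := isIso_map_of_isIso_pullbackMap q δ <| by
    refine isIso_of_isPullback_of_isPullback h₁ h₂ ?_ (pullbackMap_snd q δ)
    exact (Category.assoc _ _ _).symm.trans ((congrArg (· ≫ _) (pullbackMap_fst q δ)).trans
      ((Category.assoc _ _ _).trans (congrArg _ hδ)))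
  have := isIso_of_reflects_iso δ (MorphismProperty.Over.pullback Γ.E ⊤ q)
  have := isIso_left δ
  refine ⟨h.prop, ?_⟩
  change IsPullback (Γ.unit h.left) h.hom (Γ.H.map (Γ.I.map h.hom)) (Γ.unit A)
  exact IsPullback.of_iso_pullback ⟨(Γ.unit_naturality h.hom).symm⟩ (@asIso _ _ _ _ δ.left this)
    hδ hδ'

end GaloisStructure

/-! ### Monadic functors and coequalizers of split pairs. -/

section

variable {C : Type u₁} [Category.{v₁} C] {D : Type u₂} [Category.{v₁} D]

theorem faithful_of_monadic (G : D ⥤ C) [MonadicRightAdjoint G] : G.Faithful :=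
  Functor.Faithful.of_iso (Monad.comparisonForget (monadicAdjunction G))

theorem reflectsIsomorphisms_of_monadic (G : D ⥤ C) [MonadicRightAdjoint G] :
    G.ReflectsIsomorphisms :=
  reflectsIsomorphisms_of_iso (Monad.comparisonForget (monadicAdjunction G))

theorem isSplitPair_of_iso {F G : D ⥤ C} (e : F ≅ G) {A B : D} (u v : A ⟶ B)
    [F.IsSplitPair u v] : G.IsSplitPair u v := by
  let s := HasSplitCoequalizer.isSplitCoequalizer (F.map u) (F.map v)
  refine ⟨_, e.inv.app B ≫ HasSplitCoequalizer.coequalizerπ (F.map u) (F.map v), ⟨?_⟩⟩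
  exact
    { rightSection := s.rightSection ≫ e.hom.app B
      leftSection := e.inv.app B ≫ s.leftSection ≫ e.hom.app A
      condition := by
        rw [NatTrans.naturality_assoc, NatTrans.naturality_assoc, s.condition]
      rightSection_π := by simp [s.rightSection_π]
      leftSection_bottom := by
        rw [Category.assoc, Category.assoc, ← e.hom.naturality, s.leftSection_bottom_assoc]
        simp
      leftSection_top := by
        rw [Category.assoc, Category.assoc, ← e.hom.naturality, s.leftSection_top_assoc]
        simp }

theorem hasColimit_of_createsColimit {G : D ⥤ C} {A B : D} (u v : A ⟶ B)
    [CreatesColimit (parallelPair u v) G] [G.IsSplitPair u v] :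
    HasCoequalizer u v ∧ PreservesColimit (parallelPair u v) G := by
  have : HasColimit (parallelPair u v ⋙ G) := by
    rw [hasColimit_iff_of_iso (diagramIsoParallelPair.{v₁} _)]
    exact inferInstanceAs <| HasCoequalizer (G.map u) (G.map v)
  exact ⟨hasColimit_of_created (parallelPair u v) G, inferInstance⟩

/-- The comparison functor of any adjunction whose right adjoint is monadic is an equivalence. -/
theorem isEquivalence_comparison_of_monadic {F : C ⥤ D} {G : D ⥤ C} (adj : F ⊣ G)
    [MonadicRightAdjoint G] : (Monad.comparison adj).IsEquivalence :=
  -- Creation of coequalizers of `G`-split pairs does not mention a left adjoint, so it passes from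
  -- the adjunction bundled in `MonadicRightAdjoint` to `adj`.
  have : Monad.CreatesColimitOfIsSplitPair G :=
    ⟨fun f g _ => Monad.createsGSplitCoequalizersOfMonadic G f g⟩
  (Monad.monadicOfCreatesGSplitCoequalizers adj).eqv

/-- Split coequalizers are absolute. -/
theorem preservesColimit_parallelPair_comp (G : D ⥤ C) {B : Type*} [Category* B] (L : C ⥤ B)
    {Y Z : D} (u v : Y ⟶ Z) [G.IsSplitPair u v] :
    PreservesColimit (parallelPair u v ⋙ G) L :=
  have : PreservesColimit (parallelPair (G.map u) (G.map v)) L := inferInstance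
  let e : parallelPair (G.map u) (G.map v) ≅ parallelPair u v ⋙ G :=
    (diagramIsoParallelPair.{v₁} (parallelPair u v ⋙ G)).symm
  preservesColimit_of_iso_diagram L e

/-- If a functor `L` reflects isomorphisms and `G ⋙ L` preserves the coequalizer of a `G`-split
pair, then so does `G`. -/
theorem preservesColimit_of_isSplitPair {B : Type*} [Category* B] {G : D ⥤ C} (L : C ⥤ B)
    [L.ReflectsIsomorphisms] {Y Z : D} (u v : Y ⟶ Z) [G.IsSplitPair u v]
    [PreservesColimit (parallelPair u v) (G ⋙ L)] : PreservesColimit (parallelPair u v) G := by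
  have : HasColimit (parallelPair u v ⋙ G) := by
    rw [hasColimit_iff_of_iso (diagramIsoParallelPair.{v₁} _)]
    exact inferInstanceAs <| HasCoequalizer (G.map u) (G.map v)
  have := preservesColimit_parallelPair_comp G L u v
  -- A functor that reflects isomorphisms reflects an existing colimit that it preserves.
  have := reflectsColimit_of_reflectsIsomorphisms (parallelPair u v ⋙ G) L
  exact preservesColimit_of_reflects_of_preserves G L

end

/-- Whether the morphism induced between the pullbacks of `f` and `f'` along `g` is invertible does
not depend on the choice of these pullbacks. -/
theorem isIso_of_isIso_isPullback {C : Type u₁} [Category.{v₁} C] {P P' Q Q' A A' B D : C}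
    {f : A ⟶ D} {f' : A' ⟶ D} {g : B ⟶ D} {a : P ⟶ A} {b : P ⟶ B} {a' : P' ⟶ A'} {b' : P' ⟶ B}
    {x : Q ⟶ A} {y : Q ⟶ B} {x' : Q' ⟶ A'} {y' : Q' ⟶ B} (h : IsPullback a b f g)
    (h' : IsPullback a' b' f' g) (e : IsPullback x y f g) (e' : IsPullback x' y' f' g)
    {k : A ⟶ A'} {u : P ⟶ P'} {v : Q ⟶ Q'} (ua : u ≫ a' = a ≫ k) (ub : u ≫ b' = b)
    (vx : v ≫ x' = x ≫ k) (vy : v ≫ y' = y) [IsIso u] : IsIso v := by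
  have : v = (e.isoIsPullback _ _ h).hom ≫ u ≫ (h'.isoIsPullback _ _ e').hom := by
    apply e'.hom_ext
    · simp only [vx, Category.assoc, IsPullback.isoIsPullback_hom_fst, ua]
      rw [← Category.assoc, IsPullback.isoIsPullback_hom_fst]
    · simp [vy, ub]
  rw [this]
  infer_instance

/-! ### Monadic and normal extensions. -/

namespace MorphismProperty

variable {C : Type u₁} [Category.{v₁} C] {E : MorphismProperty C} [E.IsMultiplicative]
  [E.IsStableUnderBaseChange] [E.HasPullbacks]

/-- If `p^*` reflects isomorphisms and `q` is the pullback of `p` along `f` in `E`, then `q^*`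
reflects isomorphisms. -/
theorem reflectsIsomorphisms_pullback {P B A A₀ : C} {p : P ⟶ B} {f : A ⟶ B} {q : A₀ ⟶ A}
    {π : A₀ ⟶ P} (h : IsPullback q π f p) (hf : E f)
    [(MorphismProperty.Over.pullback E ⊤ p).ReflectsIsomorphisms] :
    (MorphismProperty.Over.pullback E ⊤ q).ReflectsIsomorphisms where
  reflects {D D'} k hk := by
    have hk' : IsIso (pullbackMap q k) := isIso_left ((MorphismProperty.Over.pullback E ⊤ q).map k)
    -- By pasting, pulling `D` back along `q` is the same as pulling `D.hom ≫ f` back along `p`. So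
    -- `q^*(k)` and `p^*(F(k))` have isomorphic underlying morphisms.
    let F := MorphismProperty.Over.map ⊤ hf
    have h₁ : IsPullback (pullback.fst D.hom q) (pullback.snd D.hom q ≫ π) (D.hom ≫ f) p :=
      (IsPullback.of_hasPullback D.hom q).paste_vert h
    have h₂ : IsPullback (pullback.fst D'.hom q) (pullback.snd D'.hom q ≫ π) (D'.hom ≫ f) p :=
      (IsPullback.of_hasPullback D'.hom q).paste_vert h
    have e₁ : IsPullback (pullback.fst (F.obj D).hom p) (pullback.snd (F.obj D).hom p)
      (D.hom ≫ f) p := IsPullback.of_hasPullback (F.obj D).hom p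
    have e₂ : IsPullback (pullback.fst (F.obj D').hom p) (pullback.snd (F.obj D').hom p)
      (D'.hom ≫ f) p := IsPullback.of_hasPullback (F.obj D').hom p
    have hqs : pullbackMap q k ≫ pullback.snd D'.hom q ≫ π = pullback.snd D.hom q ≫ π :=
      (Category.assoc _ _ _).symm.trans (congrArg (· ≫ π) (pullbackMap_snd q k))
    have := isIso_map_of_isIso_pullbackMap p (F.map k)
      (isIso_of_isIso_isPullback h₁ h₂ e₁ e₂ (pullbackMap_fst q k) hqs
        (pullbackMap_fst p (F.map k)) (pullbackMap_snd p (F.map k)))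
    have := isIso_of_reflects_iso (F.map k) (MorphismProperty.Over.pullback E ⊤ p)
    have : IsIso k.left := isIso_left (F.map k)
    exact isIso_of_isIso_left k

end MorphismProperty

namespace GaloisStructure

variable {C : Type u₁} [Category.{v₁} C] {X : Type u₂} [Category.{v₂} X]
  {Γ : GaloisStructure C X}

/-- If a monadic extension `p` factors as `g ≫ f` with `f` an extension, then `f` is monadic. -/
theorem IsMonadicExtension.of_comp {P A B : C} {p : P ⟶ B} (hp : Γ.IsMonadicExtension p)
    {g : P ⟶ A} {f : A ⟶ B} (hf : Γ.E f) (w : p = g ≫ f) : Γ.IsMonadicExtension f := by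
  obtain ⟨hpE, ⟨_⟩⟩ := hp
  have := Γ.E.hasPullback p hf
  have h := IsPullback.of_hasPullback f p
  have := reflectsIsomorphisms_of_monadic (MorphismProperty.Over.pullback Γ.E ⊤ p)
  have hq := MorphismProperty.reflectsIsomorphisms_pullback h hf
  let e := MorphismProperty.Over.pullbackComp (P := Γ.E) (Q := ⊤) g f p w
  have hf' : (MorphismProperty.Over.pullback Γ.E ⊤ f).ReflectsIsomorphisms := by
    have := reflectsIsomorphisms_of_iso e
    exact reflectsIsomorphisms_of_comp _ (MorphismProperty.Over.pullback Γ.E ⊤ g)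
  -- These identify the two base changes around the pullback square of `f` and `p`. The functor
  -- `g^*` need not reflect isomorphisms, but base change along `pullback.fst f p` does, so
  -- preservation of coequalizers by `f^*` is tested there.
  let e₁ := MorphismProperty.Over.pullbackComp (P := Γ.E) (Q := ⊤) (pullback.fst f p) f
  let e₂ := MorphismProperty.Over.pullbackComp (P := Γ.E) (Q := ⊤) (pullback.snd f p) p
    (pullback.fst f p ≫ f) h.w
  have hsplit {Y Z : Γ.E.Over ⊤ B} (u v : Y ⟶ Z)
      [(MorphismProperty.Over.pullback Γ.E ⊤ f).IsSplitPair u v] :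
      (MorphismProperty.Over.pullback Γ.E ⊤ p).IsSplitPair u v :=
    have : (MorphismProperty.Over.pullback Γ.E ⊤ f ⋙
        MorphismProperty.Over.pullback Γ.E ⊤ g).IsSplitPair u v :=
      map_is_split_pair (MorphismProperty.Over.pullback Γ.E ⊤ g) _ _
    isSplitPair_of_iso e.symm u v
  have : Monad.HasCoequalizerOfIsSplitPair (MorphismProperty.Over.pullback Γ.E ⊤ f) := by
    constructor
    intro Y Z u v _
    have := hsplit u v
    have := Monad.createsGSplitCoequalizersOfMonadic (MorphismProperty.Over.pullback Γ.E ⊤ p) u v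
    exact (hasColimit_of_createsColimit (G := MorphismProperty.Over.pullback Γ.E ⊤ p) u v).1
  have : Monad.PreservesColimitOfIsSplitPair (MorphismProperty.Over.pullback Γ.E ⊤ f) := by
    constructor
    intro Y Z u v _
    have := hsplit u v
    have := Monad.createsGSplitCoequalizersOfMonadic (MorphismProperty.Over.pullback Γ.E ⊤ p) u v
    have := (hasColimit_of_createsColimit (G := MorphismProperty.Over.pullback Γ.E ⊤ p) u v).2
    -- The pair is also `p^*`-split, so its image under `p^*` has an absolute coequalizer, which
    -- every further base change preserves.
    have := preservesColimit_parallelPair_comp (MorphismProperty.Over.pullback Γ.E ⊤ p)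
      (MorphismProperty.Over.pullback Γ.E ⊤ (pullback.snd f p)) u v
    have : PreservesColimit (parallelPair u v) (MorphismProperty.Over.pullback Γ.E ⊤ p ⋙
      MorphismProperty.Over.pullback Γ.E ⊤ (pullback.snd f p)) := inferInstance
    have := preservesColimit_of_natIso (parallelPair u v) (e₂.symm ≪≫ e₁)
    exact preservesColimit_of_isSplitPair
      (MorphismProperty.Over.pullback Γ.E ⊤ (pullback.fst f p)) u v
  exact ⟨hf, ⟨Monad.monadicOfHasPreservesGSplitCoequalizersOfReflectsIsomorphisms
    (MorphismProperty.Over.mapPullbackAdj Γ.E ⊤ f hf trivial)⟩⟩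

/-- The objects split by a monadic extension `p` via a split epimorphism are normal extensions. -/
theorem SSpl_le_NExt (hΓ : Γ.PreservesSplitPullbacks) (hadm : Γ.split.IsAdmissible) {P B : C}
    {p : P ⟶ B} (hp : Γ.IsMonadicExtension p) : Γ.SSpl p ≤ Γ.NExt B := by
  intro f hf
  obtain ⟨ht, hs⟩ := hf
  have hpb := IsPullback.of_hasPullback f.hom p
  -- A section of `p^*(f)` followed by the projection to the domain of `f` factors `p` through `f`.
  have hg : (section_ (Γ.baseChange p f) ≫ pullback.fst f.hom p) ≫ f.hom = p := by
    rw [Category.assoc, hpb.w]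
    exact IsSplitEpi.id_assoc (Γ.baseChange p f) p
  refine ⟨hp.of_comp f.prop hg.symm, ?_⟩
  obtain ⟨hpE, ⟨_⟩⟩ := hp
  have := reflectsIsomorphisms_of_monadic (MorphismProperty.Over.pullback Γ.E ⊤ p)
  have := MorphismProperty.reflectsIsomorphisms_pullback hpb f.prop
  have hpf := IsPullback.of_hasPullback f.hom f.hom
  let h : Γ.E.Over ⊤ f.left := (MorphismProperty.Over.pullback Γ.E ⊤ f.hom).obj f
  have hq : Γ.E (pullback.fst f.hom p) := Γ.E.of_isPullback hpb.flip hpE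
  have hhs : IsSplitEpi h.hom := IsSplitEpi.mk' ⟨hpf.lift (𝟙 _) (𝟙 _) rfl, hpf.lift_snd _ _ _⟩
  refine isTrivialExtension_of_pullback hΓ hq h hhs ?_
  -- The base change of `f^*(f)` along `pullback.fst f.hom p` is the pullback of `f` along either
  -- side of the square `hpb`. It is therefore a base change of `p^*(f)`, so it inherits triviality.
  have h₁ : IsPullback _ (Γ.baseChange (pullback.fst f.hom p) h) f.hom
      (pullback.fst f.hom p ≫ f.hom) :=
    (IsPullback.of_hasPullback h.hom (pullback.fst f.hom p)).paste_horiz hpf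
  rw [hpb.w] at h₁
  exact ht.of_isPullback hadm hs (IsPullback.of_right' h₁ hpb)

/-- Here `p^*(f)` is the base change along `g` of `f^*(f)`, which is trivial by normality and split
by the diagonal. -/
theorem SSpl_of_NExt (hadm : Γ.split.IsAdmissible) {P B : C}
    {p : P ⟶ B} {f : Γ.E.Over ⊤ B} (hf : Γ.NExt B f) (g : P ⟶ f.left) (w : g ≫ f.hom = p) :
    Γ.SSpl p f := by
  have hpf := IsPullback.of_hasPullback f.hom f.hom
  have hs : IsSplitEpi (Γ.baseChange f.hom f) :=
    IsSplitEpi.mk' ⟨hpf.lift (𝟙 _) (𝟙 _) rfl, hpf.lift_snd _ _ _⟩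
  have h := IsPullback.of_hasPullback f.hom p
  rw [← w] at h
  have h' := IsPullback.of_right' h hpf
  subst w
  exact ⟨hf.2.of_isPullback hadm hs h', isSplitEpi_of_isPullback h' hs⟩

/-! ### Descent along monadic extensions. -/

section Descent

variable {P B : C} {p : P ⟶ B}

/-- Descent for morphisms along a monadic extension. -/
theorem IsMonadicExtension.exists_pullbackMap_eq (hp : Γ.IsMonadicExtension p)
    {f f' : Γ.E.Over ⊤ B} (h : pullback f.hom p ⟶ pullback f'.hom p)
    (hs : h ≫ pullback.snd f'.hom p = pullback.snd f.hom p)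
    (hh : ∀ {T : C} (x y : T ⟶ pullback f.hom p), x ≫ pullback.fst _ _ = y ≫ pullback.fst _ _ →
      x ≫ h ≫ pullback.fst _ _ = y ≫ h ≫ pullback.fst _ _) :
    ∃ k : f ⟶ f', pullbackMap p k = h := by
  obtain ⟨hpE, ⟨_⟩⟩ := hp
  let adj := MorphismProperty.Over.mapPullbackAdj Γ.E ⊤ p hpE trivial
  have := isEquivalence_comparison_of_monadic adj
  let F := MorphismProperty.Over.map ⊤ hpE
  let G := MorphismProperty.Over.pullback Γ.E ⊤ p
  let h' : G.obj f ⟶ G.obj f' := MorphismProperty.Over.homMk h hs trivial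
  let ε (g : Γ.E.Over ⊤ B) : F.obj (G.obj g) ⟶ g := adj.counit.app g
  let t (g : Γ.E.Over ⊤ B) : pullback (F.obj (G.obj g)).hom p ⟶ pullback g.hom p :=
    pullback.fst _ _
  let q (g : Γ.E.Over ⊤ B) : pullback g.hom p ⟶ g.left := pullback.fst _ _
  have e₁ (g : Γ.E.Over ⊤ B) : pullbackMap p (ε g) ≫ q g = t g ≫ q g := pullbackMap_fst p (ε g)
  have e₂ : pullbackMap p (F.map h') ≫ t f' = t f ≫ h := pullbackMap_fst p (F.map h')
  -- The algebra structure on `p^*(f)` sends `((a, e), e')` to `(a, e')`. So `h` is an algebra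
  -- morphism as soon as the first component of `h (a, e)` depends on `a` alone, which is `hh`.
  have key : pullbackMap p (F.map h') ≫ pullbackMap p (ε f') = pullbackMap p (ε f) ≫ h := by
    apply pullback.hom_ext
    · change (_ ≫ _) ≫ q f' = (_ ≫ _) ≫ q f'
      rw [Category.assoc, e₁, ← Category.assoc, e₂, Category.assoc, Category.assoc]
      exact hh _ _ (e₁ f).symm
    · rw [Category.assoc, Category.assoc, hs]
      refine (congrArg _ (pullbackMap_snd p (ε f'))).trans ?_
      exact (pullbackMap_snd p (F.map h')).trans (pullbackMap_snd p (ε f)).symm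
  let H : (Monad.comparison adj).obj f ⟶ (Monad.comparison adj).obj f' :=
    { f := h', h := MorphismProperty.Over.Hom.ext key }
  obtain ⟨k, hk⟩ := (Monad.comparison adj).map_surjective H
  exact ⟨k, congrArg (fun l => l.f.left) hk⟩

/-- Descent for objects along a monadic extension `p`: an extension `π` with an action of the
kernel pair of `p` is the pullback along `p` of an extension. -/
theorem IsMonadicExtension.exists_of_action (hp : Γ.IsMonadicExtension p) {A₀ : C} {π : A₀ ⟶ P}
    (hπ : Γ.E π) [HasPullback (π ≫ p) p] (a : pullback (π ≫ p) p ⟶ A₀)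
    (ha : a ≫ π = pullback.snd (π ≫ p) p)
    (hunit : ∀ x : A₀ ⟶ pullback (π ≫ p) p, x ≫ pullback.fst _ _ = 𝟙 _ →
      x ≫ pullback.snd _ _ = π → x ≫ a = 𝟙 _)
    (hassoc : ∀ {T : C} (u v w : T ⟶ pullback (π ≫ p) p),
      u ≫ pullback.fst _ _ = w ≫ pullback.fst _ _ → v ≫ pullback.fst _ _ = u ≫ a →
      v ≫ pullback.snd _ _ = w ≫ pullback.snd _ _ → v ≫ a = w ≫ a) :
    ∃ (f : Γ.E.Over ⊤ B) (j : pullback f.hom p ≅ A₀), j.hom ≫ π = pullback.snd f.hom p ∧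
      ∀ {T : C} (x y : T ⟶ pullback f.hom p) (t : T ⟶ pullback (π ≫ p) p),
        x ≫ pullback.fst _ _ = y ≫ pullback.fst _ _ → t ≫ pullback.fst _ _ = x ≫ j.hom →
        t ≫ pullback.snd _ _ = y ≫ pullback.snd _ _ → t ≫ a = y ≫ j.hom := by
  obtain ⟨hpE, ⟨_⟩⟩ := hp
  let adj := MorphismProperty.Over.mapPullbackAdj Γ.E ⊤ p hpE trivial
  have := isEquivalence_comparison_of_monadic adj
  let F := MorphismProperty.Over.map ⊤ hpE
  let G := MorphismProperty.Over.pullback Γ.E ⊤ p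
  let N : Γ.E.Over ⊤ P := MorphismProperty.Over.mk ⊤ π hπ
  let a' : G.obj (F.obj N) ⟶ N := MorphismProperty.Over.homMk a ha trivial
  let ε (g : Γ.E.Over ⊤ B) : F.obj (G.obj g) ⟶ g := adj.counit.app g
  -- The monad sends `π` to the second projection of the pullback of `π ≫ p` and `p`. The laws are
  -- `a (x, π x) = x` and `a (a (x, e), e') = a (x, e')`, read at generic elements.
  let N' : adj.toMonad.Algebra :=
    { A := N
      a := a'
      unit := by
        apply MorphismProperty.Over.Hom.ext
        have hl : 𝟙 A₀ ≫ π ≫ p = π ≫ p := Category.id_comp _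
        exact hunit (pullback.lift (𝟙 A₀) π hl) (pullback.lift_fst _ _ _) (pullback.lift_snd _ _ _)
      assoc := by
        apply MorphismProperty.Over.Hom.ext
        let u : pullback (F.obj (G.obj (F.obj N))).hom p ⟶ pullback (π ≫ p) p := pullback.fst _ _
        exact (hassoc u (pullbackMap p (F.map a')) (pullbackMap p (ε (F.obj N)))
          (pullbackMap_fst p (ε (F.obj N))).symm (pullbackMap_fst p (F.map a'))
          ((pullbackMap_snd p (F.map a')).trans
            (pullbackMap_snd p (ε (F.obj N))).symm)).symm }
  let f := (Monad.comparison adj).objPreimage N'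
  let i := (Monad.comparison adj).objObjPreimageIso N'
  let i' : G.obj f ≅ N := (adj.toMonad.forget).mapIso i
  have hi : G.map (F.map i'.hom) ≫ a' = G.map (ε f) ≫ i'.hom := i.hom.h
  let j : pullback f.hom p ≅ A₀ :=
    ((MorphismProperty.Over.forget Γ.E ⊤ P) ⋙ Over.forget P).mapIso i'
  have hj : j.hom ≫ π = pullback.snd f.hom p := MorphismProperty.Over.w i'.hom
  refine ⟨f, j, hj, fun x y t hxy htx hty => ?_⟩
  let b : pullback (F.obj (G.obj f)).hom p ⟶ pullback (π ≫ p) p := pullbackMap p (F.map i'.hom)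
  let c := pullbackMap p (ε f)
  let d : pullback (F.obj (G.obj f)).hom p ⟶ pullback f.hom p := pullback.fst _ _
  let e : pullback (F.obj (G.obj f)).hom p ⟶ P := pullback.snd _ _
  have hd : IsPullback d e (pullback.snd f.hom p ≫ p) p :=
    IsPullback.of_hasPullback (F.obj (G.obj f)).hom p
  -- The isomorphism `j` intertwines `a` with the canonical action on `p^*(f)`; evaluating this at
  -- the pair formed by `x` and the image of `y` in `P` gives the claim.
  have hi' : b ≫ a = c ≫ j.hom := congrArg (fun l => l.left) hi
  have hb₁ : b ≫ pullback.fst _ _ = d ≫ j.hom := pullbackMap_fst p (F.map i'.hom)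
  have hb₂ : b ≫ pullback.snd _ _ = e := pullbackMap_snd p (F.map i'.hom)
  have hc₁ : c ≫ pullback.fst _ _ = d ≫ pullback.fst _ _ := pullbackMap_fst p (ε f)
  have hc₂ : c ≫ pullback.snd _ _ = e := pullbackMap_snd p (ε f)
  have hs : x ≫ pullback.snd f.hom p ≫ p = (y ≫ pullback.snd f.hom p) ≫ p := by
    rw [Category.assoc, ← pullback.condition, ← Category.assoc, hxy, Category.assoc]
  have st : hd.lift _ _ hs ≫ b = t := by
    apply pullback.hom_ext
    · rw [Category.assoc, hb₁, hd.lift_fst_assoc, htx]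
    · rw [Category.assoc, hb₂, hd.lift_snd, hty]
  have sy : hd.lift _ _ hs ≫ c = y := by
    apply pullback.hom_ext
    · rw [Category.assoc, hc₁, hd.lift_fst_assoc, hxy]
    · rw [Category.assoc, hc₂, hd.lift_snd]
  calc
    t ≫ a = (hd.lift _ _ hs ≫ b) ≫ a := by rw [st]
    _ = (hd.lift _ _ hs ≫ c) ≫ j.hom := by rw [Category.assoc, hi', Category.assoc]
    _ = y ≫ j.hom := by rw [sy]

end Descent

end GaloisStructure

/-! ### The functor to discrete fibrations over the Galois groupoid. -/

namespace GaloisStructure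

open InternalGroupoid

variable {C : Type u₁} [Category.{v₁} C] {X : Type u₂} [Category.{v₂} X]
  {Γ : GaloisStructure C X}

section

variable {P B A A₀ : C} {p : P ⟶ B} (hp : Γ.E p) {q : A₀ ⟶ A} (hq : Γ.E q) {f : A ⟶ B}
  {π : A₀ ⟶ P} (w : q ≫ f = π ≫ p)

/-- The internal functor between the groupoids of two extensions induced by a commutative
square. -/
noncomputable def kernelGroupoidHom : Γ.kernelGroupoid q hq ⟶ Γ.kernelGroupoid p hp :=
  haveI := Γ.hasPullback_kernelPair hp
  haveI := Γ.E.hasPullback (pullback.fst p p) (Γ.E_snd hp)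
  haveI := Γ.hasPullback_kernelPair hq
  haveI := Γ.E.hasPullback (pullback.fst q q) (Γ.E_snd hq)
  kernelPairHom π f w

variable (sq : IsPullback q π f p)

-- An arrow `(e, e')` of `Eq(p)` has a unique lift starting at `(a, e)`, namely the pair of `(a, e)`
-- and `(a, e')`.
include sq in
theorem isPullback_kernelGroupoidHom_d :
    IsPullback (Γ.kernelGroupoid q hq).d (kernelGroupoidHom hp hq w).f₁ π
      (Γ.kernelGroupoid p hp).d := by
  have := Γ.hasPullback_kernelPair hp
  have := Γ.hasPullback_kernelPair hq
  change IsPullback (pullback.fst q q) (kernelPairArr π f w) π (pullback.fst p p)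
  refine IsPullback.of_bot ?_ (kernelPairArr_fst π f w).symm (IsPullback.of_hasPullback p p)
  rw [kernelPairArr_snd, ← w]
  exact (IsPullback.of_hasPullback q q).paste_vert sq

include sq in
theorem isPullback_kernelGroupoidHom_c :
    IsPullback (Γ.kernelGroupoid q hq).c (kernelGroupoidHom hp hq w).f₁ π
      (Γ.kernelGroupoid p hp).c := by
  have := Γ.hasPullback_kernelPair hp
  have := Γ.hasPullback_kernelPair hq
  change IsPullback (pullback.snd q q) (kernelPairArr π f w) π (pullback.snd p p)
  refine IsPullback.of_bot ?_ (kernelPairArr_snd π f w).symm (IsPullback.of_hasPullback p p).flip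
  rw [kernelPairArr_fst, ← w]
  exact (IsPullback.of_hasPullback q q).flip.paste_vert sq

variable (hΓ : Γ.PreservesSplitPullbacks)

/-- The internal functor between Galois groupoids induced by a commutative square. -/
noncomputable def galoisGroupoidHom : Γ.galoisGroupoid hΓ q hq ⟶ Γ.galoisGroupoid hΓ p hp :=
  mapHom Γ.I (kernelGroupoidHom hp hq w) _ _ _ _

/-- The discrete fibration over the Galois groupoid of `p` given by the pullback along `p` of an
extension `f`, if this pullback is a split epimorphism. -/
noncomputable def discFib (hf : Γ.E f) (hs : IsSplitEpi π) :
    DiscFib (splitPart Γ.F) (Γ.galoisGroupoid hΓ p hp) :=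
  let F := galoisGroupoidHom hp (Γ.E.of_isPullback sq.flip hp) sq.w hΓ
  have hq := Γ.E.of_isPullback sq.flip hp
  have hπ : Γ.E π := Γ.E.of_isPullback sq hf
  have hd : IsPullback _ (Hom.f₁ F) (Hom.f₀ F) _ := by
    have := Γ.hasPullback_kernelPair hp
    exact hΓ _ _ _ _ (isPullback_kernelGroupoidHom_d hp hq sq.w sq) hs hπ (Γ.E_fst hp)
  have hc : IsPullback _ (Hom.f₁ F) (Hom.f₀ F) _ := by
    have := Γ.hasPullback_kernelPair hp
    exact hΓ _ _ _ _ (isPullback_kernelGroupoidHom_c hp hq sq.w sq) hs hπ (Γ.E_snd hp)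
  have hF : IsDiscreteFibration F := .of_isPullback hd hc
  have h₀ : splitPart Γ.F (Hom.f₀ F) := Γ.split.map_I π ⟨hπ, hs⟩
  have h₁ : splitPart Γ.F (Hom.f₁ F) := (splitPart Γ.F).of_isPullback hd h₀
  ⟨Over.mk F, hF, h₀, h₁, (splitPart Γ.F).of_isPullback hF.p₁ h₁⟩

variable {A' A₀' : C} {q' : A₀' ⟶ A'} {f' : A' ⟶ B} {π' : A₀' ⟶ P} (sq' : IsPullback q' π' f' p)

/-- The morphism of discrete fibrations induced by a morphism of extensions. -/
noncomputable def discFibHom (hf : Γ.E f) (hs : IsSplitEpi π) (hf' : Γ.E f') (hs' : IsSplitEpi π')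
    (h : A₀ ⟶ A₀') (k : A ⟶ A') (hk : q ≫ k = h ≫ q') (hπ : h ≫ π' = π) :
    discFib hp sq hΓ hf hs ⟶ discFib hp sq' hΓ hf' hs' :=
  have hq := Γ.E.of_isPullback sq.flip hp
  have hq' := Γ.E.of_isPullback sq'.flip hp
  let φ := kernelGroupoidHom hq' hq hk
  have hφ : φ.f₁ ≫ (kernelGroupoidHom hp hq' sq'.w).f₁ = (kernelGroupoidHom hp hq sq.w).f₁ := by
    have := Γ.hasPullback_kernelPair hp
    have := Γ.hasPullback_kernelPair hq
    have := Γ.hasPullback_kernelPair hq'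
    change kernelPairArr h k hk ≫ kernelPairArr π' f' sq'.w = kernelPairArr π f sq.w
    apply pullback.hom_ext
    · rw [Category.assoc, kernelPairArr_fst, ← Category.assoc, kernelPairArr_fst, Category.assoc,
        hπ, kernelPairArr_fst]
    · rw [Category.assoc, kernelPairArr_snd, ← Category.assoc, kernelPairArr_snd, Category.assoc,
        hπ, kernelPairArr_snd]
  DiscFib.homMk (A := discFib hp sq hΓ hf hs) (B := discFib hp sq' hΓ hf' hs')
    (Γ.I.map h) (Γ.I.map φ.f₁)
    ((Γ.I.map_comp _ _).symm.trans (congrArg _ hπ))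
    ((Γ.I.map_comp _ _).symm.trans (congrArg _ hφ))
    ((Γ.I.map_comp _ _).symm.trans ((congrArg _ φ.w_d).trans (Γ.I.map_comp _ _)))
    ((Γ.I.map_comp _ _).symm.trans ((congrArg _ φ.w_c).trans (Γ.I.map_comp _ _)))

end

section

variable {P B : C} {p : P ⟶ B} (hp : Γ.E p) (hΓ : Γ.PreservesSplitPullbacks)

theorem pullbackMap_id (p : P ⟶ B) (f : Γ.E.Over ⊤ B) :
    pullbackMap p (𝟙 f) = 𝟙 _ :=
  congrArg (fun l => l.left) ((MorphismProperty.Over.pullback Γ.E ⊤ p).map_id f)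

theorem pullbackMap_comp (p : P ⟶ B) {f g h : Γ.E.Over ⊤ B} (k : f ⟶ g) (l : g ⟶ h) :
    pullbackMap p (k ≫ l) = pullbackMap p k ≫ pullbackMap p l :=
  congrArg (fun l => l.left) ((MorphismProperty.Over.pullback Γ.E ⊤ p).map_comp k l)

/-- The functor that sends an extension split by `p` to the image under `I` of the kernel pair of
the pullback of `p` along it. -/
noncomputable def toDiscFib :
    (Γ.SSpl p).FullSubcategory ⥤ DiscFib (splitPart Γ.F) (Γ.galoisGroupoid hΓ p hp) where
  obj f := discFib hp (IsPullback.of_hasPullback f.obj.hom p) hΓ f.obj.prop f.property.2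
  map {f g} k := discFibHom hp (IsPullback.of_hasPullback f.obj.hom p) hΓ
    (IsPullback.of_hasPullback g.obj.hom p) f.obj.prop f.property.2 g.obj.prop g.property.2
    (pullbackMap p k.hom) k.hom.left (pullbackMap_fst p k.hom).symm (pullbackMap_snd p k.hom)
  map_id f := DiscFib.hom_ext <|
    (congrArg Γ.I.map (pullbackMap_id p f.obj)).trans (Γ.I.map_id _)
  map_comp k l := DiscFib.hom_ext <|
    (congrArg Γ.I.map (pullbackMap_comp p k.hom l.hom)).trans (Γ.I.map_comp _ _)

/-- Base change along a monadic extension is faithful, and a morphism into the trivial extension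
`p^*(g)` over `P` is determined by its image under `I`. -/
theorem faithful_toDiscFib (hm : Γ.IsMonadicExtension p) : (toDiscFib hp hΓ).Faithful where
  map_injective {f g} k l h := by
    obtain ⟨-, ⟨_⟩⟩ := hm
    have := faithful_of_monadic (MorphismProperty.Over.pullback Γ.E ⊤ p)
    apply ObjectProperty.hom_ext
    apply (MorphismProperty.Over.pullback Γ.E ⊤ p).map_injective
    apply MorphismProperty.Over.Hom.ext
    change pullbackMap p k.hom = pullbackMap p l.hom
    have ht : Γ.IsTrivialExtension (Γ.baseChange p g.obj) := g.property.1
    apply ht.hom_ext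
    · exact (pullbackMap_snd p k.hom).trans (pullbackMap_snd p l.hom).symm
    · exact congrArg DiscFib.homObj h

theorem full_toDiscFib (hm : Γ.IsMonadicExtension p) : (toDiscFib hp hΓ).Full where
  map_surjective {f g} k := by
    have sf := IsPullback.of_hasPullback f.obj.hom p
    have sg := IsPullback.of_hasPullback g.obj.hom p
    have ht : Γ.IsTrivialExtension (Γ.baseChange p g.obj) := g.property.1
    obtain ⟨h, hh, hI⟩ := ht.exists_lift (Γ.baseChange p f.obj) (DiscFib.homObj k)
      (DiscFib.homObj_comp k)
    let Gf := Γ.kernelGroupoid _ (Γ.E.of_isPullback sf.flip hp)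
    let Gg := Γ.kernelGroupoid _ (Γ.E.of_isPullback sg.flip hp)
    let φ : Gf ⟶ _ := kernelGroupoidHom hp (Γ.E.of_isPullback sf.flip hp) sf.w
    let γ : Gg ⟶ _ := kernelGroupoidHom hp (Γ.E.of_isPullback sg.flip hp) sg.w
    let G := Γ.kernelGroupoid p hp
    let d : G.G₁ ⟶ P := G.d
    let c : G.G₁ ⟶ P := G.c
    let df : Gf.G₁ ⟶ pullback f.obj.hom p := Gf.d
    let cf : Gf.G₁ ⟶ pullback f.obj.hom p := Gf.c
    let dg : Gg.G₁ ⟶ pullback g.obj.hom p := Gg.d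
    let cg : Gg.G₁ ⟶ pullback g.obj.hom p := Gg.c
    have hd : IsPullback dg γ.f₁ (Γ.baseChange p g.obj) d :=
      isPullback_kernelGroupoidHom_d hp (Γ.E.of_isPullback sg.flip hp) sg.w sg
    have hφd : df ≫ Γ.baseChange p f.obj = φ.f₁ ≫ d := φ.w_d
    have hφc : cf ≫ Γ.baseChange p f.obj = φ.f₁ ≫ c := φ.w_c
    have hγc : cg ≫ Γ.baseChange p g.obj = γ.f₁ ≫ c := γ.w_c
    have hw : (df ≫ h) ≫ Γ.baseChange p g.obj = φ.f₁ ≫ d := by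
      rw [Category.assoc, hh, hφd]
    -- The arrow component that `h` forces, by unique lifting along the discrete fibration `γ`.
    let h₁ : Gf.G₁ ⟶ Gg.G₁ := hd.lift (df ≫ h) φ.f₁ hw
    have h₁d : h₁ ≫ dg = df ≫ h := hd.lift_fst _ _ _
    have h₁f : h₁ ≫ γ.f₁ = φ.f₁ := hd.lift_snd _ _ _
    have hI₁ : Γ.I.map h₁ = DiscFib.homArr k := by
      apply DiscFib.arr_hom_ext ((toDiscFib hp hΓ).obj g)
      · refine ((Γ.I.map_comp _ _).symm.trans (congrArg Γ.I.map h₁d)).trans ?_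
        exact ((Γ.I.map_comp _ _).trans (congrArg (Γ.I.map df ≫ ·) hI)).trans
          (Hom.w_d k.hom.left)
      · exact ((Γ.I.map_comp _ _).symm.trans (congrArg Γ.I.map h₁f)).trans
          (DiscFib.homArr_comp k).symm
    -- Compatibility with codomains is not part of the construction of `h₁`. It is checked under
    -- `I`, where it holds because `k` is an internal functor.
    have h₁c : h₁ ≫ cg = cf ≫ h := by
      apply ht.hom_ext
      · rw [Category.assoc, Category.assoc, hh, hγc, hφc, ← Category.assoc, h₁f]
      · rw [Γ.I.map_comp, Γ.I.map_comp, hI, hI₁]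
        exact (Hom.w_c k.hom.left).symm
    -- Two elements with the same image in the domain of `f` form an arrow `z` of `Gf`. Its image
    -- under `h₁` is an arrow of `Gg`, which is the descent condition.
    obtain ⟨κ, hκ⟩ := hm.exists_pullbackMap_eq h hh (by
      intro T x y hxy
      have := Γ.hasPullback_kernelPair (Γ.E.of_isPullback sf.flip hp)
      let z : T ⟶ Gf.G₁ := pullback.lift x y hxy
      have zd : z ≫ df = x := pullback.lift_fst _ _ _
      have zc : z ≫ cf = y := pullback.lift_snd _ _ _
      have := Γ.hasPullback_kernelPair (Γ.E.of_isPullback sg.flip hp)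
      have hc : dg ≫ pullback.fst g.obj.hom p = cg ≫ pullback.fst g.obj.hom p :=
        pullback.condition
      rw [← zd, ← zc, Category.assoc, Category.assoc, ← Category.assoc df, ← Category.assoc cf,
        ← h₁d, ← h₁c, Category.assoc, Category.assoc, hc])
    refine ⟨ObjectProperty.homMk κ, DiscFib.hom_ext ?_⟩
    exact (congrArg Γ.I.map hκ).trans hI

end

/-! ### From a discrete fibration to an action, and essential surjectivity. -/

section

variable {P B : C} {p : P ⟶ B} (hp : Γ.E p)

theorem kernelGroupoid_hom_ext {T : C} {x y : T ⟶ (Γ.kernelGroupoid p hp).G₁}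
    (hd : x ≫ (Γ.kernelGroupoid p hp).d = y ≫ (Γ.kernelGroupoid p hp).d)
    (hc : x ≫ (Γ.kernelGroupoid p hp).c = y ≫ (Γ.kernelGroupoid p hp).c) : x = y := by
  have := Γ.hasPullback_kernelPair hp
  exact pullback.hom_ext (f := p) (g := p) hd hc

theorem exists_kernelGroupoid_lift {T : C} (x y : T ⟶ P) (h : x ≫ p = y ≫ p) :
    ∃ r : T ⟶ (Γ.kernelGroupoid p hp).G₁, r ≫ (Γ.kernelGroupoid p hp).d = x ∧
      r ≫ (Γ.kernelGroupoid p hp).c = y := by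
  have := Γ.hasPullback_kernelPair hp
  exact ⟨pullback.lift (f := p) (g := p) x y h, pullback.lift_fst (f := p) (g := p) _ _ _,
    pullback.lift_snd (f := p) (g := p) _ _ _⟩

variable {hp} {hΓ : Γ.PreservesSplitPullbacks} {Q : InternalGroupoid X}
  (φ : Q ⟶ Γ.galoisGroupoid hΓ p hp)

/-- Lifts of composable arrows compose to a lift of the composite. This yields associativity of the
induced action without `I` preserving the pullback on which the action is defined. -/
theorem galoisGroupoid_comp_map {S : C} {r s : S ⟶ (Γ.kernelGroupoid p hp).G₁}
    (hrs : r ≫ (Γ.kernelGroupoid p hp).c = s ≫ (Γ.kernelGroupoid p hp).d)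
    {x y : Γ.I.obj S ⟶ Q.G₁} (hxy : x ≫ Q.c = y ≫ Q.d)
    (hx : x ≫ Hom.f₁ φ = Γ.I.map r) (hy : y ≫ Hom.f₁ φ = Γ.I.map s) :
    (Q.isPullback.lift x y hxy ≫ Q.m) ≫ Hom.f₁ φ =
      Γ.I.map ((Γ.kernelGroupoid p hp).isPullback.lift r s hrs ≫ (Γ.kernelGroupoid p hp).m) := by
  have h : Q.isPullback.lift x y hxy ≫ Hom.f₂ φ =
      Γ.I.map ((Γ.kernelGroupoid p hp).isPullback.lift r s hrs) := by
    apply (Γ.galoisGroupoid hΓ p hp).isPullback.hom_ext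
    · rw [Category.assoc, ← Hom.w_p₁, IsPullback.lift_fst_assoc, hx]
      exact (congrArg Γ.I.map ((Γ.kernelGroupoid p hp).isPullback.lift_fst r s hrs)).symm.trans
        (Γ.I.map_comp _ _)
    · rw [Category.assoc, ← Hom.w_p₂, IsPullback.lift_snd_assoc, hy]
      exact (congrArg Γ.I.map ((Γ.kernelGroupoid p hp).isPullback.lift_snd r s hrs)).symm.trans
        (Γ.I.map_comp _ _)
  rw [Category.assoc, Hom.w_m, ← Category.assoc, h]
  exact (Γ.I.map_comp _ _).symm

variable (hφ : IsDiscreteFibration φ) {A₀ T : C} {π : A₀ ⟶ P} (hπ : Γ.IsTrivialExtension π)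
  (t : Γ.I.obj A₀ ≅ Q.G₀) (ht : t.hom ≫ Hom.f₀ φ = Γ.I.map π)
  {u₀ : T ⟶ A₀} {u₁ : T ⟶ P}

include hφ ht in
/-- Lifting along a discrete fibration over the Galois groupoid. -/
theorem exists_arr_lift {S : C} (x : S ⟶ A₀) (r : S ⟶ (Γ.kernelGroupoid p hp).G₁)
    (hr : r ≫ (Γ.kernelGroupoid p hp).d = x ≫ π) :
    ∃ z : Γ.I.obj S ⟶ Q.G₁, z ≫ Q.d = Γ.I.map x ≫ t.hom ∧ z ≫ Hom.f₁ φ = Γ.I.map r := by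
  have h : (Γ.I.map x ≫ t.hom) ≫ Hom.f₀ φ =
      Γ.I.map r ≫ (Γ.galoisGroupoid hΓ p hp).d := by
    rw [Category.assoc, ht]
    exact (Γ.I.map_comp _ _).symm.trans ((congrArg Γ.I.map hr).symm.trans (Γ.I.map_comp _ _))
  exact ⟨hφ.d.lift _ _ h, hφ.d.lift_fst _ _ _, hφ.d.lift_snd _ _ _⟩

include hφ hπ ht in
/-- A discrete fibration over the Galois groupoid of `p` induces an action of the kernel pair
of `p` on a trivial extension. -/
theorem exists_action (hu : (u₀ ≫ π) ≫ p = u₁ ≫ p) :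
    ∃ a : T ⟶ A₀, a ≫ π = u₁ ∧ ∀ {S : C} (x : S ⟶ T) (r : S ⟶ (Γ.kernelGroupoid p hp).G₁)
      (z : Γ.I.obj S ⟶ Q.G₁), r ≫ (Γ.kernelGroupoid p hp).d = (x ≫ u₀) ≫ π →
      r ≫ (Γ.kernelGroupoid p hp).c = x ≫ u₁ → z ≫ Q.d = Γ.I.map (x ≫ u₀) ≫ t.hom →
      z ≫ Hom.f₁ φ = Γ.I.map r → z ≫ Q.c = Γ.I.map (x ≫ a) ≫ t.hom := by
  -- The generic arrow from `u₀ ≫ π` to `u₁`: the codomain of the lift of its image under `I`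
  -- prescribes `I(a)`, and triviality of `π` produces `a`.
  obtain ⟨r₁, hd, hc⟩ := exists_kernelGroupoid_lift hp (u₀ ≫ π) u₁ hu
  obtain ⟨t₁, ht₁, ht₁'⟩ := exists_arr_lift φ hφ t ht u₀ r₁ hd
  have hk : (t₁ ≫ Q.c ≫ t.inv) ≫ Γ.I.map π = Γ.I.map u₁ := by
    have h : t.inv ≫ Γ.I.map π = Hom.f₀ φ := (Iso.inv_comp_eq t).2 ht.symm
    rw [Category.assoc, Category.assoc, h]
    refine (congrArg (t₁ ≫ ·) φ.w_c).trans ((Category.assoc _ _ _).symm.trans ?_)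
    rw [ht₁']
    exact (Γ.I.map_comp _ _).symm.trans (congrArg Γ.I.map hc)
  obtain ⟨a, ha, ha'⟩ := hπ.exists_lift u₁ _ hk
  refine ⟨a, ha, fun x r z hrd hrc hzd hzf => ?_⟩
  have hr : r = x ≫ r₁ := by
    apply kernelGroupoid_hom_ext hp
    · rw [hrd, Category.assoc, Category.assoc, hd]
      rfl
    · rw [hrc, Category.assoc, hc]
      rfl
  -- Unique lifting lets the action be computed by any lift at any stage, so units and composites in
  -- `Q` may serve as lifts.
  have hz : z = Γ.I.map x ≫ t₁ := by
    apply hφ.d.hom_ext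
    · rw [hzd, Category.assoc, ht₁, Γ.I.map_comp, Category.assoc]
    · rw [hzf, Category.assoc, ht₁', hr]
      exact Γ.I.map_comp _ _
  rw [hz, Γ.I.map_comp, ha']
  simp

end

section

variable {P B : C} {p : P ⟶ B} (hp : Γ.IsMonadicExtension p) (hΓ : Γ.PreservesSplitPullbacks)
  (hadm : Γ.split.IsAdmissible)

include hp hadm in
theorem essSurj_toDiscFib : (toDiscFib hp.1 hΓ).EssSurj where
  mem_essImage D := by
    let Q : InternalGroupoid X := D.obj.left
    let G := Γ.kernelGroupoid p hp.1
    let φ : Q ⟶ Γ.galoisGroupoid hΓ p hp.1 := D.obj.hom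
    have hφ : IsDiscreteFibration φ := D.property.1
    let f₀ : Q.G₀ ⟶ Γ.I.obj P := Hom.f₀ φ
    have hf₀ : splitPart Γ.F f₀ := D.property.2.1
    have := Γ.E.hasPullback (Γ.unit P) (Γ.map_H f₀ hf₀.1)
    have hA := IsPullback.of_hasPullback (Γ.H.map f₀) (Γ.unit P)
    set A₀ := pullback (Γ.H.map f₀) (Γ.unit P)
    set π := pullback.snd (Γ.H.map f₀) (Γ.unit P)
    obtain ⟨hπ, t, ht⟩ := isTrivialExtension_of_isPullback hadm hf₀ hA
    have hπs : IsSplitEpi π := (splitPart Γ.E).of_isPullback hA (Γ.split.map_H _ hf₀) |>.2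
    have := Γ.E.hasPullback p (Γ.E.comp_mem _ _ hπ.1 hp.1)
    obtain ⟨a, ha, key⟩ := exists_action φ hφ hπ t ht
      (u₀ := pullback.fst (π ≫ p) p) (u₁ := pullback.snd (π ≫ p) p)
      (by rw [Category.assoc]; exact pullback.condition)
    obtain ⟨f, j, hj, hja⟩ := hp.exists_of_action hπ.1 a ha
      (by
        intro x hx₀ hx₁
        apply hπ.hom_ext
        · rw [Category.assoc, ha, hx₁, Category.id_comp]
        · have hed : (π ≫ G.e) ≫ G.d = π :=
            (Category.assoc _ _ _).trans ((congrArg (π ≫ ·) G.e_d).trans (Category.comp_id _))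
          have hec : (π ≫ G.e) ≫ G.c = π :=
            (Category.assoc _ _ _).trans ((congrArg (π ≫ ·) G.e_c).trans (Category.comp_id _))
          have hf : (t.hom ≫ Q.e) ≫ Hom.f₁ φ = Γ.I.map (π ≫ G.e) := by
            rw [Category.assoc, φ.w_e]
            exact (Category.assoc _ _ _).symm.trans
              ((congrArg (· ≫ Γ.I.map G.e) ht).trans (Γ.I.map_comp _ _).symm)
          -- The unit of `Q` lifts the unit of `Eq(p)` and has equal source and target.
          have := key x (π ≫ G.e) (t.hom ≫ Q.e) (by rw [hx₀, Category.id_comp]; exact hed)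
            (by rw [hx₁]; exact hec)
            (by rw [hx₀, Category.assoc, Q.e_d, Γ.I.map_id, Category.comp_id, Category.id_comp]) hf
          rw [← cancel_mono t.hom, ← this, Category.assoc, Q.e_c, Γ.I.map_id, Category.comp_id,
            Category.id_comp])
      (by
        intro S u v w h₀ h₁ h₂
        have hc : ∀ z : S ⟶ pullback (π ≫ p) p,
            ((z ≫ pullback.fst (π ≫ p) p) ≫ π) ≫ p = (z ≫ pullback.snd (π ≫ p) p) ≫ p := by
          intro z
          rw [Category.assoc, Category.assoc, pullback.condition, Category.assoc]
        have hva : (v ≫ pullback.fst (π ≫ p) p) ≫ π = u ≫ pullback.snd (π ≫ p) p := by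
          rw [h₁, Category.assoc, ha]
        obtain ⟨r, hrd, hrc⟩ := exists_kernelGroupoid_lift hp.1 _ _ (hc u)
        obtain ⟨s, hsd, hsc⟩ := exists_kernelGroupoid_lift hp.1 _ _ (hc v)
        obtain ⟨x, hxd, hxf⟩ := exists_arr_lift φ hφ t ht _ r hrd
        obtain ⟨y, hyd, hyf⟩ := exists_arr_lift φ hφ t ht _ s hsd
        have hrs : r ≫ G.c = s ≫ G.d := by rw [hrc, hsd, hva]
        have hxc := key u r x hrd hrc hxd hxf
        have hyc := key v s y hsd hsc hyd hyf
        have hxy : x ≫ Q.c = y ≫ Q.d := by rw [hxc, hyd, h₁]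
        apply hπ.hom_ext
        · rw [Category.assoc, Category.assoc, ha, h₂]
        · have := key w (G.isPullback.lift r s hrs ≫ G.m) (Q.isPullback.lift x y hxy ≫ Q.m)
            (by rw [Category.assoc, G.m_d, IsPullback.lift_fst_assoc, hrd, h₀])
            (by rw [Category.assoc, G.m_c, IsPullback.lift_snd_assoc, hsc, h₂])
            (by rw [Category.assoc, Q.m_d, IsPullback.lift_fst_assoc, hxd, h₀])
            (galoisGroupoid_comp_map φ hrs hxy hxf hyf)
          rw [Category.assoc, Q.m_c, IsPullback.lift_snd_assoc, hyc, cancel_mono] at this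
          exact this)
    have hpb := IsPullback.of_hasPullback f.hom p
    have hsq : IsPullback j.hom (Γ.baseChange p f) π (𝟙 P) :=
      IsPullback.of_horiz_isIso ⟨by rw [hj, Category.comp_id]⟩
    have hf : Γ.SSpl p f := ⟨hπ.of_isPullback hadm hπs hsq, isSplitEpi_of_isPullback hsq hπs⟩
    refine ⟨⟨f, hf⟩, ?_⟩
    have hq := Γ.E.of_isPullback hpb.flip hp.1
    let K := Γ.kernelGroupoid _ hq
    let Kd : K.G₁ ⟶ pullback f.hom p := K.d
    let Kc : K.G₁ ⟶ pullback f.hom p := K.c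
    let d : G.G₁ ⟶ P := G.d
    let c : G.G₁ ⟶ P := G.c
    let ψ : K ⟶ G := kernelGroupoidHom hp.1 hq hpb.w
    have hψd : ψ.f₁ ≫ d = (Kd ≫ j.hom) ≫ π := by
      rw [Category.assoc, hj]
      exact ψ.w_d.symm
    have hψc : ψ.f₁ ≫ c = Kc ≫ pullback.snd f.hom p := ψ.w_c.symm
    -- The arrow component of the isomorphism to `D`. Its codomain condition says that `j` carries
    -- the canonical action on `p^*(f)` to `a`.
    obtain ⟨h₁, h₁d, h₁f⟩ := exists_arr_lift φ hφ t ht (Kd ≫ j.hom) ψ.f₁ hψd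
    have hw : Kd ≫ pullback.fst f.hom p = Kc ≫ pullback.fst f.hom p := by
      have := Γ.hasPullback_kernelPair hq
      exact pullback.condition
    let x : K.G₁ ⟶ pullback (π ≫ p) p := pullback.lift (Kd ≫ j.hom)
      (Kc ≫ pullback.snd f.hom p) (by
        rw [Category.assoc, ← Category.assoc j.hom, hj, Category.assoc, ← hpb.w,
          ← Category.assoc, hw, Category.assoc])
    have hx₀ : x ≫ pullback.fst (π ≫ p) p = Kd ≫ j.hom := pullback.lift_fst _ _ _
    have hx₁ : x ≫ pullback.snd (π ≫ p) p = Kc ≫ pullback.snd f.hom p := pullback.lift_snd _ _ _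
    have hxa := hja _ _ x hw hx₀ hx₁
    have h₁c := key x ψ.f₁ h₁ (by rw [hx₀]; exact hψd) (by rw [hx₁]; exact hψc)
      (by rw [hx₀, h₁d]) h₁f
    rw [hxa] at h₁c
    exact DiscFib.nonempty_iso (A := (toDiscFib hp.1 hΓ).obj ⟨f, hf⟩) (B := D)
      (Γ.I.map j.hom ≫ t.hom) h₁
      ((Category.assoc _ _ _).trans ((congrArg _ ht).trans
        ((Γ.I.map_comp _ _).symm.trans (congrArg Γ.I.map hj))))
      h₁f
      ((Category.assoc _ _ _).symm.trans ((congrArg (· ≫ t.hom) (Γ.I.map_comp _ _)).symm.trans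
        h₁d.symm))
      ((Category.assoc _ _ _).symm.trans ((congrArg (· ≫ t.hom) (Γ.I.map_comp _ _)).symm.trans
        h₁c.symm))
      (Γ.I.mapIso j ≪≫ t).isIso_hom

end

end GaloisStructure

theorem theorem3p3 {C : Type u₁} [Category.{v₁} C] {X : Type u₂} [Category.{v₂} X]
    (Γ : GaloisStructure C X) (hΓ : Γ.PreservesSplitPullbacks) (hadm : Γ.split.IsAdmissible)
    {P B : C} (p : P ⟶ B) (hp : Γ.IsMonadicExtension p) :
    Nonempty ((Γ.SSpl p).FullSubcategory ≌
      InternalGroupoid.DiscFib (splitPart Γ.F) (Γ.galoisGroupoid hΓ p hp.1)) ∧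
    (Γ.SSpl p = Γ.NExt B →
      Nonempty ((Γ.NExt B).FullSubcategory ≌
        InternalGroupoid.DiscFib (splitPart Γ.F) (Γ.galoisGroupoid hΓ p hp.1))) ∧
    (IsWeaklyInitialIn (Γ.MExt B) (MorphismProperty.Over.mk ⊤ p hp.1) →
      Γ.SSpl p = Γ.NExt B) ∧
    (IsWeaklyInitialIn (Γ.NExt B) (MorphismProperty.Over.mk ⊤ p hp.1) →
      Γ.SSpl p = Γ.NExt B) := by
  have e : Nonempty ((Γ.SSpl p).FullSubcategory ≌
      InternalGroupoid.DiscFib (splitPart Γ.F) (Γ.galoisGroupoid hΓ p hp.1)) := by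
    have := GaloisStructure.faithful_toDiscFib hp.1 hΓ hp
    have := GaloisStructure.full_toDiscFib hp.1 hΓ hp
    have := GaloisStructure.essSurj_toDiscFib hp hΓ hadm
    have : (GaloisStructure.toDiscFib hp.1 hΓ).IsEquivalence := { }
    exact ⟨(GaloisStructure.toDiscFib hp.1 hΓ).asEquivalence⟩
  refine ⟨e, fun h => h ▸ e, fun hw => ?_, fun hw => ?_⟩
  · refine le_antisymm (GaloisStructure.SSpl_le_NExt hΓ hadm hp) fun f hf => ?_
    obtain ⟨g⟩ := hw.2 f hf.1
    exact GaloisStructure.SSpl_of_NExt hadm hf g.left (MorphismProperty.Over.w g)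
  · refine le_antisymm (GaloisStructure.SSpl_le_NExt hΓ hadm hp) fun f hf => ?_
    obtain ⟨g⟩ := hw.2 f hf
    exact GaloisStructure.SSpl_of_NExt hadm hf g.left (MorphismProperty.Over.w g)
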